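/- \textbf{Setting.} Let $(W,S)$ be a Coxeter system with length function $\ell$. For $u,v\in W$ write $u\le v$ (Bruhat order) if some reduced word of $v$ has a subword that is a reduced word of $u$. For $I,J\subseteq S$ let $W_I$ be the subgroup generated by $I$, let ${}^{I}W^{J}=\{u\in W : u\le v \text{ for all } v\in W_IuW_J\}$, with ${}^{I}W={}^{I}W^{\emptyset}$ and $W^{J}={}^{\emptyset}W^{J}$, and let ${}^{I}w^{J}$ be the minimum of $W_IwW_J$. A \emph{generalized Renner--Coxeter system} $(R,\Lambda,S)$ consists of a monoid $R$ with group of units $W$ and set of idempotents $E(R)$, a set $\Lambda\subseteq E(R)$ and a set $S\subseteq W$ such that: (i) $R=E(R)W=WE(R)$ and idempotents commute (so $E(R)$ is a meet semilattice with meet $ef$ for the order $e\le f\Leftrightarrow ef=fe=e$); (ii) $\Lambda$ is a transversal of $E(R)$ for the conjugation action of $W$ and is closed under meets; (iii) $(W,S)$ is a Coxeter system; (iv) for all $e\le e'$ in $E(R)$ there are $w\in W$ and $f\le f'$ in $\Lambda$ with $wew^{-1}=f$ and $we'w^{-1}=f'$; (v) for $e\le f$ in $\Lambda$, $\lambda^*(e)\subseteq\lambda^*(f)$,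 where $\lambda^*(e)=\{s\in S: se=es\ne e\}$; (vi) for $e\in\Lambda$ the groups $\{w\in W: we=ew\}$ and $\{w\in W: we=ew=e\}$ are standard parabolic subgroups; they are $W_{\lambda(e)}$ and $W_{\lambda_*(e)}$, where $\lambda(e)=\{s\in S: se=es\}$ and $\lambda_*(e)=\{s\in S: se=es=e\}$. Every $r\in R$ is uniquely $r=xey$ with $e\in\Lambda$, $x\in W^{\lambda_*(e)}$, $y\in{}^{\lambda(e)}W$ (left standard form). If $r=xey$ and $s=afb$ are in left standard form, then $r\le^+s$ means that $e\le f$ and there is $w\in W_{\lambda^*(f)}W_{\lambda_*(e)}$ with $x\le aw$ and $w^{-1}b\le y$. Green's relations on $R$ are: $r\,\mathcal J\,s$ iff $RrR=RsR$; $r\,\mathcal L\,s$ iff $Rr=Rs$; $r\,\mathcal R\,s$ iff $rR=sR$; $r\,\mathcal H\,s$ iff $r\,\mathcal L\,s$ and $r\,\mathcal R\,s$. Assume that $R$ is finite, let $w_0$ be the longest element of $W$, and put $\Lambda^-=w_0\Lambda w_0$; for $e\in\Lambda^-$ the sets $\lambda(e),\lambda_*(e),\lambda^*(e)$ are defined by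 the same formulas. A factorization $r=\sigma_-e_-\sigma_0e_+\sigma_+$ is the \emph{vanilla form} of $r$ if $e_+\in\Lambda$, $e_-\in\Lambda^-$, $e_-\,\mathcal J\,r\,\mathcal J\,e_+$, $\sigma_+\in{}^{\lambda(e_+)}W$, $\sigma_-\in W^{\lambda(e_-)}$, and $\sigma_0\in W_{\lambda^*(e_-)}\bigl({}^{\lambda_*(e_-)}w_0{}^{\lambda_*(e_+)}\bigr)W_{\lambda^*(e_+)}$. Every element of $R$ has a unique vanilla form. \textbf{Corollary.} Let $(R,\Lambda,S)$ be a generalized Renner--Coxeter system with $R$ finite, and let $r,s\in R$ have vanilla forms $r=\sigma_-e_-\sigma_0e_+\sigma_+$ and $s=\tau_-f_-\tau_0f_+\tau_+$. (1) If $r\,\mathcal J\,s$, then $r\le^+s$ if and only if there exist $w_-\in W_{\lambda^*(e_-)}$ and $w_+\in W_{\lambda^*(e_+)}$ such that $\tau_-w_-^{-1}\le\sigma_-$, $\sigma_0\le w_-\tau_0w_+$ and $w_+^{-1}\tau_+\le\sigma_+$. (2) If $r\,\mathcal L\,s$, then $r\le^+s$ if and only if $\sigma_-\sigma_0\le\tau_-\tau_0$.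 (3) If $r\,\mathcal R\,s$, then $r\le^+s$ if and only if $\sigma_0\sigma_+\le\tau_0\tau_+$. (4) If $r\,\mathcal H\,s$, then $r\le^+s$ if and only if $\sigma_0\le\tau_0$. -/

import Mathlib

open scoped Pointwise

/-! ### Coxeter groups: parabolic subgroups, Bruhat order, longest element -/

namespace CoxeterSystem

variable {B W : Type*} [Group W] {M : CoxeterMatrix B} (cs : CoxeterSystem M W)

/-- The standard parabolic subgroup `W_I`, generated by the simple reflections indexed by `I`. -/
def parabolic (I : Set B) : Subgroup W := Subgroup.closure (cs.simple '' I)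

/-- The Bruhat order: some reduced word of `v` has a subword that is a reduced word of `u`. -/
def BruhatLE (u v : W) : Prop :=
  ∃ ω ω' : List B, cs.IsReduced ω ∧ cs.wordProd ω = v ∧
    cs.IsReduced ω' ∧ cs.wordProd ω' = u ∧ ω'.Sublist ω

/-- The double coset `W_I w W_J`. -/
def parabolicDoubleCoset (I J : Set B) (w : W) : Set W :=
  DoubleCoset.doubleCoset w (cs.parabolic I) (cs.parabolic J)

/-- The set `^I W ^J` of minimum representatives of double cosets:
the `u` with `u ≤ v` for all `v ∈ W_I u W_J`. -/
def minReps (I J : Set B) : Set W :=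
  {u | ∀ v ∈ cs.parabolicDoubleCoset I J u, cs.BruhatLE u v}

/-- `d` is the Bruhat-minimum element `^I w ^J` of the double coset `W_I w W_J`. -/
def IsMinOfDoubleCoset (I J : Set B) (w d : W) : Prop :=
  d ∈ cs.parabolicDoubleCoset I J w ∧
    ∀ v ∈ cs.parabolicDoubleCoset I J w, cs.BruhatLE d v

/-- The longest element `w₀` of a finite Coxeter group. -/
noncomputable def longest [Finite W] : W :=
  Classical.choose (Finite.exists_max cs.length)

theorem length_le_length_longest [Finite W] (w : W) :
    cs.length w ≤ cs.length cs.longest :=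
  Classical.choose_spec (Finite.exists_max cs.length) w

end CoxeterSystem

/-! ### Monoids: factorizability, order on idempotents, Green's relations -/

section Monoids

variable {R : Type*} [Monoid R]

/-- A factorizable monoid: `R = E(R)G(R) = G(R)E(R)`, and the idempotents form a meet semilattice
(they commute, so that `e * f` is the meet of `e` and `f`). -/
structure IsFactorizable (R : Type*) [Monoid R] : Prop where
  exists_idem_mul_unit : ∀ r : R, ∃ (e : R) (g : Rˣ), IsIdempotentElem e ∧ r = e * g
  exists_unit_mul_idem : ∀ r : R, ∃ (g : Rˣ) (e : R), IsIdempotentElem e ∧ r = g * e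
  idem_comm : ∀ e f : R, IsIdempotentElem e → IsIdempotentElem f → e * f = f * e

/-- The order on idempotents: `e ≤ f` iff `e f = f e = e`. -/
def IdemLE (e f : R) : Prop := e * f = e ∧ f * e = e

/-- Green's relation `J`: `RrR = RsR`. -/
def GreenJ (r s : R) : Prop := {x : R | ∃ a b, x = a * r * b} = {x : R | ∃ a b, x = a * s * b}

/-- Green's relation `L`: `Rr = Rs`. -/
def GreenL (r s : R) : Prop := {x : R | ∃ a, x = a * r} = {x : R | ∃ a, x = a * s}

/-- Green's relation `R`: `rR = sR`. -/
def GreenR (r s : R) : Prop := {x : R | ∃ b, x = r * b} = {x : R | ∃ b, x = s * b}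

/-- Green's relation `H`. -/
def GreenH (r s : R) : Prop := GreenL r s ∧ GreenR r s

end Monoids

/-! ### Type maps -/

namespace CoxeterSystem

variable {R B : Type*} [Monoid R] {M : CoxeterMatrix B} (cs : CoxeterSystem M Rˣ)

/-- The type map `λ(e) = {s ∈ S | s e = e s}`. -/
def typeMap (e : R) : Set B := {i | (cs.simple i : R) * e = e * cs.simple i}

/-- The lower type map `λ_*(e) = {s ∈ S | s e = e s = e}`. -/
def lowerType (e : R) : Set B := {i | (cs.simple i : R) * e = e ∧ e * cs.simple i = e}

/-- The upper type map `λ^*(e) = {s ∈ S | s e = e s ≠ e}`. -/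
def upperType (e : R) : Set B :=
  {i | (cs.simple i : R) * e = e * cs.simple i ∧ (cs.simple i : R) * e ≠ e}

end CoxeterSystem

/-! ### Generalized Renner-Coxeter systems -/

/-- A generalized Renner-Coxeter system `(R, Λ, S)`. The group of units `Rˣ` plays the role of `W`,
and `S` is the family of simple reflections of the Coxeter system `cs` on `Rˣ`. -/
structure RennerCoxeterSystem (R : Type*) [Monoid R] {B : Type*} (M : CoxeterMatrix B) where
  /-- the Coxeter system `(W, S)` on the group of units -/
  cs : CoxeterSystem M Rˣ
  /-- the cross-sectional lattice -/
  Lam : Set R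
  factorizable : IsFactorizable R
  idem_of_mem : ∀ e ∈ Lam, IsIdempotentElem e
  /-- every conjugacy class of idempotents meets `Λ` in exactly one point -/
  transversal : ∀ e : R, IsIdempotentElem e →
    ∃! f : R, f ∈ Lam ∧ ∃ w : Rˣ, (w : R) * e * ((w⁻¹ : Rˣ) : R) = f
  /-- `Λ` is closed under meets of idempotents -/
  mul_mem : ∀ e ∈ Lam, ∀ f ∈ Lam, e * f ∈ Lam
  exists_conj_pair : ∀ e e' : R, IsIdempotentElem e → IsIdempotentElem e' → IdemLE e e' →
    ∃ w : Rˣ, ∃ f ∈ Lam, ∃ f' ∈ Lam, IdemLE f f' ∧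
      (w : R) * e * ((w⁻¹ : Rˣ) : R) = f ∧ (w : R) * e' * ((w⁻¹ : Rˣ) : R) = f'
  upperType_mono : ∀ e ∈ Lam, ∀ f ∈ Lam, IdemLE e f → cs.upperType e ⊆ cs.upperType f
  centralizer_parabolic : ∀ e ∈ Lam, ∃ I : Set B, ∀ w : Rˣ,
    (w : R) * e = e * w ↔ w ∈ cs.parabolic I
  stabilizer_parabolic : ∀ e ∈ Lam, ∃ I : Set B, ∀ w : Rˣ,
    ((w : R) * e = e ∧ e * w = e) ↔ w ∈ cs.parabolic I

namespace RennerCoxeterSystem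

variable {R B : Type*} [Monoid R] {M : CoxeterMatrix B} (Q : RennerCoxeterSystem R M)

/-- `{w ∈ W | w e = e w} = W_{λ(e)}`. -/
theorem comm_iff_mem_parabolic_typeMap {e : R} (he : e ∈ Q.Lam) (w : Rˣ) :
    (w : R) * e = e * w ↔ w ∈ Q.cs.parabolic (Q.cs.typeMap e) := by
  obtain ⟨I, hI⟩ := Q.centralizer_parabolic e he
  rw [hI]
  have hle : Q.cs.parabolic I ≤ Q.cs.parabolic (Q.cs.typeMap e) := by
    refine Subgroup.closure_mono (Set.image_mono fun i hi => ?_)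
    exact (hI _).2 (Subgroup.subset_closure ⟨i, hi, rfl⟩)
  refine ⟨fun h => hle h, fun h => ?_⟩
  refine (Subgroup.closure_le _).2 ?_ h
  rintro _ ⟨i, hi, rfl⟩
  exact (hI _).1 hi

/-- `{w ∈ W | w e = e w = e} = W_{λ_*(e)}`. -/
theorem fix_iff_mem_parabolic_lowerType {e : R} (he : e ∈ Q.Lam) (w : Rˣ) :
    ((w : R) * e = e ∧ e * w = e) ↔ w ∈ Q.cs.parabolic (Q.cs.lowerType e) := by
  obtain ⟨I, hI⟩ := Q.stabilizer_parabolic e he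
  rw [hI]
  have hle : Q.cs.parabolic I ≤ Q.cs.parabolic (Q.cs.lowerType e) := by
    refine Subgroup.closure_mono (Set.image_mono fun i hi => ?_)
    exact (hI _).2 (Subgroup.subset_closure ⟨i, hi, rfl⟩)
  refine ⟨fun h => hle h, fun h => ?_⟩
  refine (Subgroup.closure_le _).2 ?_ h
  rintro _ ⟨i, hi, rfl⟩
  exact (hI _).1 hi

/-- `r = x e y` is in left standard form: `e ∈ Λ`, `x ∈ W^{λ_*(e)}`, `y ∈ ^{λ(e)}W`. -/
structure IsLeftStandardForm (r : R) (x : Rˣ) (e : R) (y : Rˣ) : Prop where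
  eq : r = x * e * y
  mem : e ∈ Q.Lam
  left_min : x ∈ Q.cs.minReps ∅ (Q.cs.lowerType e)
  right_min : y ∈ Q.cs.minReps (Q.cs.typeMap e) ∅

/-- The Adherence order `r ≤⁺ s`, computed on left standard forms `r = x e y`, `s = a f b`:
`e ≤ f` and there is `w ∈ W_{λ^*(f)} W_{λ_*(e)}` with `x ≤ a w` and `w⁻¹ b ≤ y`. -/
def AdherenceLE (r s : R) : Prop :=
  ∃ (x : Rˣ) (e : R) (y a : Rˣ) (f : R) (b : Rˣ),
    Q.IsLeftStandardForm r x e y ∧ Q.IsLeftStandardForm s a f b ∧ IdemLE e f ∧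
      ∃ w ∈ (Q.cs.parabolic (Q.cs.upperType f) : Set Rˣ) * (Q.cs.parabolic (Q.cs.lowerType e)),
        Q.cs.BruhatLE x (a * w) ∧ Q.cs.BruhatLE (w⁻¹ * b) y

/-- The opposite cross-sectional lattice `Λ⁻ = w₀ Λ w₀`. -/
def oppLam [Finite R] : Set R :=
  {e | ∃ f ∈ Q.Lam, e = (Q.cs.longest : R) * f * (Q.cs.longest : R)}

/-- `r = σ₋ e₋ σ₀ e₊ σ₊` is in vanilla form. -/
structure IsVanillaForm [Finite R] (r : R) (σm : Rˣ) (em : R) (σ0 : Rˣ) (ep : R) (σp : Rˣ) :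
    Prop where
  eq : r = σm * em * σ0 * ep * σp
  ep_mem : ep ∈ Q.Lam
  em_mem : em ∈ Q.oppLam
  em_greenJ : GreenJ em r
  ep_greenJ : GreenJ r ep
  σp_min : σp ∈ Q.cs.minReps (Q.cs.typeMap ep) ∅
  σm_min : σm ∈ Q.cs.minReps ∅ (Q.cs.typeMap em)
  /-- `σ₀ ∈ W_{λ^*(e₋)} (^{λ_*(e₋)} w₀ ^{λ_*(e₊)}) W_{λ^*(e₊)}` -/
  σ0_mem : ∃ d : Rˣ,
    Q.cs.IsMinOfDoubleCoset (Q.cs.lowerType em) (Q.cs.lowerType ep) Q.cs.longest d ∧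
      σ0 ∈ Q.cs.parabolicDoubleCoset (Q.cs.upperType em) (Q.cs.upperType ep) d

end RennerCoxeterSystem

/-! For a vanilla form, e₋ = w₀e₊w₀ and w₀σ₀ ∈ W_{λ(e₊)}, hence e₋σ₀ = σ₀e₊, and (σ₋σ₀)e₊σ₊ is the
left standard form of r (`isLeftStandardForm`). Elements of one J-class share e₋ and e₊, so r ≤⁺ s
asks for v ∈ W_{λ^*(e₊)} and u ∈ W_{λ_*(e₊)} with σ₋σ₀ ≤ τ₋τ₀vu and (vu)⁻¹τ₊ ≤ σ₊. By minimality in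
cosets of W_{λ_*(e₊)}, u can be dropped.

It remains to split σ₋σ₀ ≤ τ₋τ₀v. The lengths of σ₋ and σ₀ do not add, but those of σ₋ and σ₀w₀ ∈
W_{λ(e₋)} do. Right multiplication by w₀ reverses the order (`BruhatLE.mul_longest`), giving τ₋τ₀vw₀
≤ σ₋(σ₀w₀), which the subword property factors. Since W_{λ(e₋)} is the product of the commuting
groups W_{λ^*(e₋)} and W_{λ_*(e₋)}, the first supplies w₋ and minimality discards the second. This
is (1). For (2)–(4), L fixes σ₊ and R fixes σ₋, and w ≠ 1 makes a minimal representative strictly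
longer, so the corresponding witness is trivial; (3) also uses the splitting with w₀ on the left.

The Bruhat order is defined through one reduced word, so its transitivity and independence of that
word (`bruhatLE_iff_chain`) are derived from strong exchange, itself obtained from an action on W ×
ℤ/2. -/

/-! ### The reflection cocycle and the strong exchange property -/

namespace CoxeterSystem

variable {B W : Type*} [Group W] {M : CoxeterMatrix B} (cs : CoxeterSystem M W)

open Classical in
/-- The action of a simple reflection on signed group elements. -/
noncomputable def reflPerm (i : B) : Equiv.Perm (W × ZMod 2) :=
  Function.Involutive.toPerm
    (fun p => (cs.simple i * p.1 * cs.simple i, p.2 + if p.1 = cs.simple i then 1 else 0)) (by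
      rintro ⟨t, z⟩
      have h : cs.simple i * t * cs.simple i = cs.simple i ↔ t = cs.simple i := by
        constructor
        · intro h
          have h2 : cs.simple i * t = 1 := by simpa using h
          rw [← inv_eq_of_mul_eq_one_right h2, cs.inv_simple]
        · rintro rfl; simp
      simp only [h, Prod.mk.injEq]
      refine ⟨by simp [← mul_assoc], ?_⟩
      rw [add_assoc, CharTwo.add_self_eq_zero, add_zero])

open Classical in
theorem reflPerm_apply (i : B) (t : W) (z : ZMod 2) :
    cs.reflPerm i (t, z) =
      (cs.simple i * t * cs.simple i, z + if t = cs.simple i then 1 else 0) := rfl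

-- The sum runs over the right inversion sequence of an alternating word of length 2k. This closed
-- form is what makes the braid relation checkable.
open Classical in
theorem reflPerm_mul_pow_apply (i j : B) (k : ℕ) (t : W) (z : ZMod 2) :
    ((cs.reflPerm i * cs.reflPerm j) ^ k) (t, z) =
      (((cs.simple j * cs.simple i) ^ k)⁻¹ * t * (cs.simple j * cs.simple i) ^ k,
        z + ∑ l ∈ Finset.range (2 * k),
          if t = (cs.simple j * cs.simple i) ^ l * cs.simple j then 1 else 0) := by
  set a := cs.simple j * cs.simple i with ha
  have hainv : a⁻¹ = cs.simple i * cs.simple j := by simp [ha]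
  -- Conjugation by s_j inverts a, so moving s_j past a^(-k) doubles the exponent.
  have hcomm : ∀ k : ℕ, a ^ k * cs.simple j * (a ^ k)⁻¹ = a ^ (2 * k) * cs.simple j := by
    intro k
    induction k with
    | zero => simp
    | succ k ih =>
      have : a ^ (k + 1) * cs.simple j * (a ^ (k + 1))⁻¹
          = a * (a ^ k * cs.simple j * (a ^ k)⁻¹) * a⁻¹ := by
        rw [pow_succ']; group
      rw [this, ih, show 2 * (k + 1) = (2 * k + 1) + 1 by ring, pow_succ a (2 * k + 1), pow_succ' a,
        hainv]
      simp [ha, mul_assoc]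
  induction k with
  | zero => simp
  | succ k ih =>
    rw [pow_succ', Equiv.Perm.mul_apply, ih, Equiv.Perm.mul_apply, reflPerm_apply, reflPerm_apply]
    have h1 : (a ^ k)⁻¹ * t * a ^ k = cs.simple j ↔ t = a ^ (2 * k) * cs.simple j := by
      rw [← hcomm]
      constructor
      · intro h; rw [← h]; group
      · rintro rfl; group
    have h2 : cs.simple j * ((a ^ k)⁻¹ * t * a ^ k) * cs.simple j = cs.simple i ↔
        t = a ^ (2 * k + 1) * cs.simple j := by
      have h3 : a ^ (2 * k + 1) * cs.simple j = a ^ k * (a * cs.simple j) * (a ^ k)⁻¹ := by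
        rw [pow_succ', mul_assoc, ← hcomm]
        have : Commute a (a ^ k) := Commute.self_pow a k
        simp only [← mul_assoc, this.eq]
      rw [h3]
      constructor
      · intro h
        have h4 : a * cs.simple j = (a ^ k)⁻¹ * t * a ^ k := by
          generalize (a ^ k)⁻¹ * t * a ^ k = q at h
          rw [ha, ← h]; simp [← mul_assoc]
        rw [h4]; group
      · rintro rfl
        simp [ha, ← mul_assoc]
    rw [Prod.mk.injEq]
    constructor
    · have : a ^ (k + 1) = a ^ k * a := pow_succ a k
      rw [this, mul_inv_rev, hainv]
      simp only [mul_assoc, ha]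
    · rw [show 2 * (k + 1) = 2 * k + 1 + 1 by ring, Finset.sum_range_succ, Finset.sum_range_succ]
      simp only [h1, h2, add_assoc]

/-- With m = M i j and a^m = 1, the summands at l and m + l agree and cancel modulo 2. -/
theorem reflPerm_isLiftable : M.IsLiftable cs.reflPerm := by
  classical
  intro i j
  ext1 ⟨t, z⟩
  have ha : (cs.simple j * cs.simple i) ^ M i j = 1 := cs.simple_mul_simple_pow' i j
  rw [reflPerm_mul_pow_apply, ha, two_mul, Finset.sum_range_add]
  simp only [pow_add, ha, one_mul, CharTwo.add_self_eq_zero]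
  simp

/-- The action of the Coxeter group on signed group elements. -/
noncomputable def reflHom : W →* Equiv.Perm (W × ZMod 2) :=
  cs.lift ⟨cs.reflPerm, cs.reflPerm_isLiftable⟩

-- The left side depends only on the product of the word, so the parity of the number of occurrences
-- of t does too.
open Classical in
theorem reflHom_wordProd_apply (ω : List B) (t : W) (z : ZMod 2) :
    cs.reflHom (cs.wordProd ω) (t, z) =
      (cs.wordProd ω * t * (cs.wordProd ω)⁻¹, z + ((cs.rightInvSeq ω).count t : ZMod 2)) := by
  induction ω with
  | nil => simp
  | cons i ω ih =>
    rw [wordProd_cons, map_mul, Equiv.Perm.mul_apply, ih]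
    have : cs.reflHom (cs.simple i) = cs.reflPerm i := cs.lift_apply_simple _ i
    rw [this, reflPerm_apply, rightInvSeq, List.count_cons]
    have h : cs.wordProd ω * t * (cs.wordProd ω)⁻¹ = cs.simple i ↔
        (cs.wordProd ω)⁻¹ * cs.simple i * cs.wordProd ω = t := by
      constructor
      · intro h; rw [← h]; group
      · rintro rfl; group
    simp only [h, beq_iff_eq, Prod.mk.injEq]
    refine ⟨by simp [mul_assoc], ?_⟩
    push_cast
    rw [add_assoc]

/-- The reflection cocycle: the parity of the number of times `t` occurs in the right inversion
sequence of a word of `w`. -/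
noncomputable def reflCocycle (w t : W) : ZMod 2 := (cs.reflHom w (t, 0)).2

open Classical in
theorem reflCocycle_wordProd (ω : List B) (t : W) :
    cs.reflCocycle (cs.wordProd ω) t = ((cs.rightInvSeq ω).count t : ZMod 2) := by
  simp [reflCocycle, reflHom_wordProd_apply]

theorem reflHom_apply (w t : W) (z : ZMod 2) :
    cs.reflHom w (t, z) = (w * t * w⁻¹, z + cs.reflCocycle w t) := by
  classical
  obtain ⟨ω, rfl⟩ := cs.wordProd_surjective w
  rw [reflCocycle_wordProd, reflHom_wordProd_apply]

theorem reflCocycle_mul (u v t : W) :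
    cs.reflCocycle (u * v) t = cs.reflCocycle v t + cs.reflCocycle u (v * t * v⁻¹) := by
  rw [reflCocycle, map_mul, Equiv.Perm.mul_apply, reflHom_apply, reflHom_apply]
  simp

theorem reflCocycle_one (t : W) : cs.reflCocycle 1 t = 0 := by
  simp [reflCocycle]

/-- For t = wsw⁻¹ the cocycle identity leaves the value 1 at s, plus contributions of w and w⁻¹ that
cancel because ww⁻¹ = 1. -/
theorem reflCocycle_self {t : W} (ht : cs.IsReflection t) : cs.reflCocycle t t = 1 := by
  classical
  obtain ⟨w, i, rfl⟩ := ht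
  have hs : cs.reflCocycle (cs.simple i) (cs.simple i) = 1 := by
    have := cs.reflCocycle_wordProd [i] (cs.simple i)
    simpa using this
  have h1 := cs.reflCocycle_mul w w⁻¹ (w * cs.simple i * w⁻¹)
  rw [mul_inv_cancel, reflCocycle_one] at h1
  have e : w⁻¹ * (w * cs.simple i * w⁻¹) * w⁻¹⁻¹ = cs.simple i := by group
  rw [e] at h1
  rw [reflCocycle_mul, e, reflCocycle_mul, hs]
  simp only [inv_simple, simple_mul_simple_cancel_right] at *
  rw [add_left_comm, ← h1, add_zero]

theorem mem_rightInvSeq_of_reflCocycle_ne_zero {ω : List B} {t : W}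
    (h : cs.reflCocycle (cs.wordProd ω) t ≠ 0) : t ∈ cs.rightInvSeq ω := by
  classical
  by_contra hn
  rw [reflCocycle_wordProd, List.count_eq_zero_of_not_mem hn] at h
  simp at h

theorem length_mul_lt_of_reflCocycle_ne_zero {w t : W} (h : cs.reflCocycle w t ≠ 0) :
    cs.length (w * t) < cs.length w := by
  obtain ⟨ω, hω, rfl⟩ := cs.exists_isReduced w
  exact (cs.isRightInversion_of_mem_rightInvSeq hω
    (cs.mem_rightInvSeq_of_reflCocycle_ne_zero h)).2

/-- If the value at w vanished, the value at wt would be 1, and (wt)t = w would be shorter than wt.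
-/
theorem reflCocycle_ne_zero_of_length_lt {w t : W} (ht : cs.IsReflection t)
    (h : cs.length (w * t) < cs.length w) : cs.reflCocycle w t ≠ 0 := by
  intro h0
  have h1 : cs.reflCocycle (w * t) t ≠ 0 := by
    rw [reflCocycle_mul, cs.reflCocycle_self ht, mul_inv_cancel_right, h0]
    decide
  have := cs.length_mul_lt_of_reflCocycle_ne_zero h1
  rw [mul_assoc, ht.mul_self, mul_one] at this
  omega

/-- The strong exchange property. -/
theorem exists_eraseIdx_of_length_mul_lt {ω : List B} {t : W} (ht : cs.IsReflection t)
    (h : cs.length (cs.wordProd ω * t) < cs.length (cs.wordProd ω)) :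
    ∃ j < ω.length, cs.wordProd ω * t = cs.wordProd (ω.eraseIdx j) := by
  have hm := cs.mem_rightInvSeq_of_reflCocycle_ne_zero
    (cs.reflCocycle_ne_zero_of_length_lt ht h)
  obtain ⟨j, hj, rfl⟩ := List.mem_iff_getElem.1 hm
  refine ⟨j, by simpa using hj, ?_⟩
  rw [← cs.wordProd_mul_getD_rightInvSeq, List.getD_eq_getElem _ _ hj]

/-- The strong exchange property for multiplication on the left. -/
theorem exists_eraseIdx_of_length_mul_lt' {ω : List B} {t : W} (ht : cs.IsReflection t)
    (h : cs.length (t * cs.wordProd ω) < cs.length (cs.wordProd ω)) :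
    ∃ j < ω.length, t * cs.wordProd ω = cs.wordProd (ω.eraseIdx j) := by
  have e : t * cs.wordProd ω = cs.wordProd ω * ((cs.wordProd ω)⁻¹ * t * cs.wordProd ω) := by group
  rw [e] at h ⊢
  refine cs.exists_eraseIdx_of_length_mul_lt ?_ h
  simpa using ht.conj (cs.wordProd ω)⁻¹

/-- A word contains a reduced word of its product as a subword. -/
theorem exists_isReduced_sublist (ω : List B) :
    ∃ ω' : List B, ω'.Sublist ω ∧ cs.IsReduced ω' ∧ cs.wordProd ω' = cs.wordProd ω := by
  induction ω with
  | nil => exact ⟨[], List.Sublist.refl _, by simp [IsReduced], rfl⟩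
  | cons i ω ih =>
    obtain ⟨ω', hs, hr, he⟩ := ih
    by_cases hd : cs.length (cs.simple i * cs.wordProd ω') < cs.length (cs.wordProd ω')
    · obtain ⟨j, hj, hje⟩ := cs.exists_eraseIdx_of_length_mul_lt' (cs.isReflection_simple i) hd
      refine ⟨ω'.eraseIdx j, ((List.eraseIdx_sublist ω' j).trans hs).cons i, ?_, ?_⟩
      · rw [IsReduced, ← hje, List.length_eraseIdx_of_lt hj]
        have := cs.length_simple_mul (cs.wordProd ω') i
        rw [hr.eq] at this hd
        omega
      · rw [← hje, wordProd_cons, he]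
    · refine ⟨i :: ω', hs.cons_cons i, ?_, by rw [wordProd_cons, wordProd_cons, he]⟩
      have := cs.length_simple_mul (cs.wordProd ω') i
      rw [IsReduced, wordProd_cons, List.length_cons, ← hr.eq]
      omega

/-! ### The Bruhat order -/

/-- One step in the Bruhat order: left multiplication by a reflection that increases the length. -/
def BruhatStep (u v : W) : Prop :=
  ∃ t, cs.IsReflection t ∧ v = t * u ∧ cs.length u < cs.length v

/-- Each step down deletes one letter by strong exchange; the remaining word may fail to be reduced
and is thinned again. The reduced word of v is arbitrary here. -/
theorem exists_sublist_of_chain {u v : W} (h : Relation.ReflTransGen cs.BruhatStep u v)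
    {ω : List B} (hω : cs.IsReduced ω) (hv : cs.wordProd ω = v) :
    ∃ ω' : List B, ω'.Sublist ω ∧ cs.IsReduced ω' ∧ cs.wordProd ω' = u := by
  induction h generalizing ω with
  | refl => exact ⟨ω, List.Sublist.refl _, hω, hv⟩
  | tail _ hst ih =>
    obtain ⟨t, ht, hc, hl⟩ := hst
    subst hv
    have hb := congrArg (t * ·) hc
    simp only [← mul_assoc, ht.mul_self, one_mul] at hb
    obtain ⟨j, -, hje⟩ := cs.exists_eraseIdx_of_length_mul_lt' (ω := ω) ht (by rw [hb]; exact hl)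
    obtain ⟨ω₁, hs₁, hr₁, he₁⟩ := cs.exists_isReduced_sublist (ω.eraseIdx j)
    obtain ⟨ω₂, hs₂, hr₂, he₂⟩ := ih hr₁ (by rw [he₁, ← hje, hb])
    exact ⟨ω₂, hs₂.trans (hs₁.trans (List.eraseIdx_sublist ω j)), hr₂, he₂⟩

theorem bruhatStep_simple_mul {u : W} {i : B} (h : cs.length u < cs.length (cs.simple i * u)) :
    cs.BruhatStep u (cs.simple i * u) :=
  ⟨_, cs.isReflection_simple i, rfl, h⟩

/-- Conjugating t by s_i carries the step along unless lengths go the wrong way. Then either s_i x <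
x < y, or s_i lengthens x and shortens y; in the latter case exchange in a reduced word of y
starting with i must delete that first letter, so s_i x = y. -/
theorem chain_simple_mul_of_step {x y : W} (i : B) (h : cs.BruhatStep x y) :
    Relation.ReflTransGen cs.BruhatStep (cs.simple i * x) y ∨
      cs.BruhatStep (cs.simple i * x) (cs.simple i * y) := by
  obtain ⟨t, ht, rfl, hl⟩ := h
  by_cases h1 : cs.length (cs.simple i * x) < cs.length (cs.simple i * (t * x))
  · refine Or.inr ⟨cs.simple i * t * cs.simple i, ?_, by simp [← mul_assoc], h1⟩
    simpa using ht.conj (cs.simple i)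
  left
  rcases cs.length_simple_mul x i with h2 | h2
  · rcases cs.length_simple_mul (t * x) i with h3 | h3
    · omega
    obtain ⟨ω, hω, he⟩ := cs.exists_isReduced (cs.simple i * (t * x))
    have he' : t * x = cs.wordProd (i :: ω) := by
      rw [wordProd_cons, ← he]; simp
    have hx : x = t * cs.wordProd (i :: ω) := by
      rw [← he', ← mul_assoc, ht.mul_self, one_mul]
    obtain ⟨j, hj, hje⟩ := cs.exists_eraseIdx_of_length_mul_lt' (ω := i :: ω) ht
      (by rw [← hx, ← he']; exact hl)
    rw [← hx] at hje
    rcases j with _ | j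
    · simp only [List.eraseIdx_zero, List.tail_cons] at hje
      rw [he', wordProd_cons, ← hje]
    · exfalso
      rw [List.eraseIdx_cons_succ, wordProd_cons] at hje
      have h4 : cs.simple i * x = cs.wordProd (ω.eraseIdx j) := by rw [hje]; simp
      have h5 := cs.length_wordProd_le (ω.eraseIdx j)
      have hj' : j < ω.length := by simpa using hj
      rw [← h4, List.length_eraseIdx_of_lt hj', ← hω.eq, ← he] at h5
      have : 0 < ω.length := by omega
      rw [← hω.eq, ← he] at this
      omega
  · refine Relation.ReflTransGen.head (b := x) ?_ (.single ⟨t, ht, rfl, hl⟩)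
    have := cs.bruhatStep_simple_mul (u := cs.simple i * x) (i := i) (by simp; omega)
    simpa using this

theorem chain_simple_mul {x y : W} (i : B) (h : Relation.ReflTransGen cs.BruhatStep x y) :
    Relation.ReflTransGen cs.BruhatStep (cs.simple i * x) y ∨
      Relation.ReflTransGen cs.BruhatStep (cs.simple i * x) (cs.simple i * y) := by
  induction h using Relation.ReflTransGen.head_induction_on with
  | refl => exact Or.inr .refl
  | head hst hrest ih =>
    rcases cs.chain_simple_mul_of_step i hst with h | h
    · exact Or.inl (h.trans hrest)
    · exact ih.imp (Relation.ReflTransGen.head h) (Relation.ReflTransGen.head h)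

theorem chain_of_sublist {ω ω' : List B} (hω : cs.IsReduced ω) (h : ω'.Sublist ω) :
    Relation.ReflTransGen cs.BruhatStep (cs.wordProd ω') (cs.wordProd ω) := by
  induction h with
  | slnil => exact .refl
  | @cons l₁ l₂ i hs ih =>
    have hr : cs.IsReduced l₂ := by simpa using hω.drop 1
    refine (ih hr).tail ?_
    rw [wordProd_cons]
    refine cs.bruhatStep_simple_mul ?_
    rw [← wordProd_cons, hω.eq, hr.eq]
    simp
  | @cons_cons l₁ l₂ i hs ih =>
    have hr : cs.IsReduced l₂ := by simpa using hω.drop 1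
    rw [wordProd_cons, wordProd_cons]
    refine (cs.chain_simple_mul i (ih hr)).elim (fun h => h.tail ?_) id
    refine cs.bruhatStep_simple_mul ?_
    rw [← wordProd_cons, hω.eq, hr.eq]
    simp

/-- Chains are visibly transitive and make no reference to a word, so "some reduced word" may be
replaced by "every reduced word". -/
theorem bruhatLE_iff_chain {u v : W} :
    cs.BruhatLE u v ↔ Relation.ReflTransGen cs.BruhatStep u v := by
  constructor
  · rintro ⟨ω, ω', hω, rfl, -, rfl, hs⟩
    exact cs.chain_of_sublist hω hs
  · intro h
    obtain ⟨ω, hω, he⟩ := cs.exists_isReduced v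
    obtain ⟨ω', hs, hr, he'⟩ := cs.exists_sublist_of_chain h hω he.symm
    exact ⟨ω, ω', hω, he.symm, hr, he', hs⟩

variable {cs}

theorem BruhatLE.exists_sublist {u v : W} (h : cs.BruhatLE u v) {ω : List B}
    (hω : cs.IsReduced ω) (hv : cs.wordProd ω = v) :
    ∃ ω' : List B, ω'.Sublist ω ∧ cs.IsReduced ω' ∧ cs.wordProd ω' = u :=
  cs.exists_sublist_of_chain (cs.bruhatLE_iff_chain.1 h) hω hv

theorem BruhatLE.of_sublist {ω ω' : List B} (hω : cs.IsReduced ω) (h : ω'.Sublist ω) :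
    cs.BruhatLE (cs.wordProd ω') (cs.wordProd ω) :=
  cs.bruhatLE_iff_chain.2 (cs.chain_of_sublist hω h)

theorem BruhatLE.trans {u v w : W} (h : cs.BruhatLE u v) (h' : cs.BruhatLE v w) :
    cs.BruhatLE u w :=
  cs.bruhatLE_iff_chain.2 ((cs.bruhatLE_iff_chain.1 h).trans (cs.bruhatLE_iff_chain.1 h'))

theorem BruhatLE.length_le {u v : W} (h : cs.BruhatLE u v) : cs.length u ≤ cs.length v := by
  obtain ⟨ω, ω', hω, rfl, hω', rfl, hs⟩ := h
  rw [hω.eq, hω'.eq]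
  exact hs.length_le

theorem BruhatLE.inv {u v : W} (h : cs.BruhatLE u v) : cs.BruhatLE u⁻¹ v⁻¹ := by
  obtain ⟨ω, ω', hω, rfl, hω', rfl, hs⟩ := h
  exact ⟨ω.reverse, ω'.reverse, hω.reverse, cs.wordProd_reverse ω, hω'.reverse,
    cs.wordProd_reverse ω', hs.reverse⟩

variable (cs)

theorem bruhatLE_refl (u : W) : cs.BruhatLE u u :=
  cs.bruhatLE_iff_chain.2 .refl

theorem bruhatLE_inv_iff {u v : W} : cs.BruhatLE u⁻¹ v⁻¹ ↔ cs.BruhatLE u v :=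
  ⟨fun h => by simpa using h.inv, fun h => h.inv⟩

/-- Products of elements below the factors of a length-additive product. -/
theorem BruhatLE.mul_of_length_add {p q u v : W} (hp : cs.BruhatLE p u) (hq : cs.BruhatLE q v)
    (h : cs.length (u * v) = cs.length u + cs.length v) : cs.BruhatLE (p * q) (u * v) := by
  obtain ⟨ω, ω', hω, rfl, -, rfl, hs⟩ := hp
  obtain ⟨ψ, ψ', hψ, rfl, -, rfl, hs'⟩ := hq
  rw [← wordProd_append, ← wordProd_append]
  refine BruhatLE.of_sublist ?_ (hs.append hs')
  rw [IsReduced, wordProd_append, h, hω.eq, hψ.eq, List.length_append]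

/-- An element below a length-additive product factors accordingly. -/
theorem BruhatLE.exists_mul_of_length_add {x u v : W} (hx : cs.BruhatLE x (u * v))
    (h : cs.length (u * v) = cs.length u + cs.length v) :
    ∃ p q, x = p * q ∧ cs.BruhatLE p u ∧ cs.BruhatLE q v := by
  obtain ⟨ω, hω, rfl⟩ := cs.exists_isReduced u
  obtain ⟨ψ, hψ, rfl⟩ := cs.exists_isReduced v
  have hr : cs.IsReduced (ω ++ ψ) := by
    rw [IsReduced, wordProd_append, h, hω.eq, hψ.eq, List.length_append]
  obtain ⟨χ, hs, -, rfl⟩ := hx.exists_sublist hr (cs.wordProd_append ω ψ)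
  obtain ⟨χ₁, χ₂, rfl, h₁, h₂⟩ := List.sublist_append_iff.1 hs
  exact ⟨_, _, cs.wordProd_append χ₁ χ₂, .of_sublist hω h₁, .of_sublist hψ h₂⟩

/-- The lifting property of the Bruhat order. -/
theorem BruhatLE.of_simple_mul {u y : W} {i : B} (hu : ¬ cs.IsLeftDescent u i)
    (h : cs.BruhatLE u (cs.simple i * y)) : cs.BruhatLE u y := by
  rcases cs.length_simple_mul y i with h1 | h1
  · obtain ⟨ω, hω, rfl⟩ := cs.exists_isReduced y
    have hr : cs.IsReduced (i :: ω) := by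
      rw [IsReduced, wordProd_cons, h1, hω.eq, List.length_cons]
    obtain ⟨χ, hs, hχ, rfl⟩ := h.exists_sublist hr (cs.wordProd_cons i ω)
    cases hs with
    | cons _ hs => exact .of_sublist hω hs
    -- If the subword keeps the leading letter i, then i is a left descent of u.
    | cons_cons _ hs =>
      rename_i χ
      have hχ' : cs.IsReduced χ := by simpa using hχ.drop 1
      refine absurd ?_ hu
      rw [IsLeftDescent, hχ.eq, wordProd_cons, simple_mul_simple_cancel_left, hχ'.eq]
      simp
  · refine h.trans (cs.bruhatLE_iff_chain.2 (.single ?_))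
    have := cs.bruhatStep_simple_mul (u := cs.simple i * y) (i := i) (by simp; omega)
    simpa using this

end CoxeterSystem

/-! ### Standard parabolic subgroups -/

namespace CoxeterSystem

variable {B W : Type*} [Group W] {M : CoxeterMatrix B} (cs : CoxeterSystem M W)

theorem simple_mem_parabolic {I : Set B} {i : B} (hi : i ∈ I) : cs.simple i ∈ cs.parabolic I :=
  Subgroup.subset_closure ⟨i, hi, rfl⟩

theorem parabolic_mono {I J : Set B} (h : I ⊆ J) : cs.parabolic I ≤ cs.parabolic J :=
  Subgroup.closure_mono (Set.image_mono h)

theorem wordProd_mem_parabolic {I : Set B} {ω : List B} (h : ∀ i ∈ ω, i ∈ I) :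
    cs.wordProd ω ∈ cs.parabolic I := by
  induction ω with
  | nil => simp
  | cons i ω ih =>
    rw [wordProd_cons]
    exact mul_mem (cs.simple_mem_parabolic (h i (by simp))) (ih fun j hj => h j (by simp [hj]))

theorem exists_isReduced_of_mem_parabolic {I : Set B} {w : W} (hw : w ∈ cs.parabolic I) :
    ∃ ω : List B, cs.IsReduced ω ∧ (∀ i ∈ ω, i ∈ I) ∧ cs.wordProd ω = w := by
  have h : ∃ ω : List B, (∀ i ∈ ω, i ∈ I) ∧ cs.wordProd ω = w := by
    induction hw using Subgroup.closure_induction with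
    | mem x hx =>
      obtain ⟨i, hi, rfl⟩ := hx
      exact ⟨[i], by simpa using hi, by simp⟩
    | one => exact ⟨[], by simp, by simp⟩
    | mul x y _ _ hx hy =>
      obtain ⟨ω, h, rfl⟩ := hx
      obtain ⟨ψ, h', rfl⟩ := hy
      refine ⟨ω ++ ψ, ?_, cs.wordProd_append ω ψ⟩
      intro i hi
      exact (List.mem_append.1 hi).elim (h i) (h' i)
    | inv x _ hx =>
      obtain ⟨ω, h, rfl⟩ := hx
      exact ⟨ω.reverse, by simpa using h, cs.wordProd_reverse ω⟩
  obtain ⟨ω, h, rfl⟩ := h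
  obtain ⟨ω', hs, hr, he⟩ := cs.exists_isReduced_sublist ω
  exact ⟨ω', hr, fun i hi => h i (hs.subset hi), he⟩

theorem BruhatLE.mem_parabolic {I : Set B} {u v : W} (h : cs.BruhatLE u v)
    (hv : v ∈ cs.parabolic I) : u ∈ cs.parabolic I := by
  obtain ⟨ω, hω, hI, rfl⟩ := cs.exists_isReduced_of_mem_parabolic hv
  obtain ⟨χ, hs, -, rfl⟩ := h.exists_sublist hω rfl
  exact cs.wordProd_mem_parabolic fun i hi => hI i (hs.subset hi)

/-- Exchange within a word over K puts s_i in W_K, where its reduced word is a single letter of K.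
-/
theorem exists_simple_eq_of_isLeftDescent {K : Set B} {v : W} (hv : v ∈ cs.parabolic K) {i : B}
    (hi : cs.IsLeftDescent v i) : ∃ k ∈ K, cs.simple i = cs.simple k := by
  obtain ⟨ω, hω, hK, rfl⟩ := cs.exists_isReduced_of_mem_parabolic hv
  obtain ⟨j, -, hj⟩ := cs.exists_eraseIdx_of_length_mul_lt' (cs.isReflection_simple i) hi
  have h1 : cs.simple i * cs.wordProd ω ∈ cs.parabolic K := by
    rw [hj]
    exact cs.wordProd_mem_parabolic fun k hk => hK k ((List.eraseIdx_sublist ω j).subset hk)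
  have h2 : cs.simple i ∈ cs.parabolic K := (Subgroup.mul_mem_cancel_right _ hv).1 h1
  obtain ⟨ψ, hψ, hK', he⟩ := cs.exists_isReduced_of_mem_parabolic h2
  have h3 : ψ.length = 1 := by rw [← hψ.eq, he, length_simple]
  obtain ⟨k, rfl⟩ := List.length_eq_one_iff.1 h3
  exact ⟨k, hK' k (by simp), by rw [← he, wordProd_singleton]⟩

/-- An element without left descents in `J` that lies below some element of a coset `W_J y` lies
below every element of that coset. -/
theorem BruhatLE.of_parabolic_mul {J : Set B} {u y z : W}
    (hu : ∀ i ∈ J, ¬ cs.IsLeftDescent u i) (hz : z ∈ cs.parabolic J)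
    (h : cs.BruhatLE u (z * y)) : cs.BruhatLE u y := by
  obtain ⟨ω, -, hJ, rfl⟩ := cs.exists_isReduced_of_mem_parabolic hz
  clear hz
  induction ω with
  | nil => simpa using h
  | cons i ω ih =>
    rw [wordProd_cons, mul_assoc] at h
    exact ih (fun j hj => hJ j (by simp [hj]))
      (BruhatLE.of_simple_mul cs (hu i (hJ i (by simp))) h)

theorem BruhatLE.of_mul_parabolic {J : Set B} {u y z : W}
    (hu : ∀ i ∈ J, ¬ cs.IsRightDescent u i) (hz : z ∈ cs.parabolic J)
    (h : cs.BruhatLE u (y * z)) : cs.BruhatLE u y := by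
  rw [← cs.bruhatLE_inv_iff] at h ⊢
  rw [mul_inv_rev] at h
  exact BruhatLE.of_parabolic_mul cs (fun i hi => by rw [isLeftDescent_inv_iff]; exact hu i hi)
    (inv_mem hz) h

theorem bruhatLE_parabolic_mul {J : Set B} {u z : W}
    (hu : ∀ i ∈ J, ¬ cs.IsLeftDescent u i) (hz : z ∈ cs.parabolic J) :
    cs.BruhatLE u (z * u) :=
  BruhatLE.of_parabolic_mul cs hu (inv_mem hz) (by simpa using cs.bruhatLE_refl u)

theorem bruhatLE_mul_parabolic {J : Set B} {u z : W}
    (hu : ∀ i ∈ J, ¬ cs.IsRightDescent u i) (hz : z ∈ cs.parabolic J) :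
    cs.BruhatLE u (u * z) :=
  BruhatLE.of_mul_parabolic cs hu (inv_mem hz) (by simpa using cs.bruhatLE_refl u)

/-- If a prepended letter shortened the product, exchange would delete a letter either from the word
of z, which is reduced, or from that of u, giving an element of W_J u shorter than u. -/
theorem length_parabolic_mul {J : Set B} {u z : W}
    (hu : ∀ i ∈ J, ¬ cs.IsLeftDescent u i) (hz : z ∈ cs.parabolic J) :
    cs.length (z * u) = cs.length z + cs.length u := by
  obtain ⟨ω, hω, hJ, rfl⟩ := cs.exists_isReduced_of_mem_parabolic hz
  clear hz
  induction ω with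
  | nil => simp
  | cons i ω ih =>
    have hr : cs.IsReduced ω := by simpa using hω.drop 1
    have hJ' : ∀ j ∈ ω, j ∈ J := fun j hj => hJ j (by simp [hj])
    have ih := ih hr hJ'
    rw [hω.eq, wordProd_cons, List.length_cons, mul_assoc]
    rw [hr.eq] at ih
    rcases cs.length_simple_mul (cs.wordProd ω * u) i with h1 | h1
    · omega
    exfalso
    obtain ⟨ψ, hψ, rfl⟩ := cs.exists_isReduced u
    rw [← wordProd_append] at h1 ih
    obtain ⟨j, hj, he⟩ := cs.exists_eraseIdx_of_length_mul_lt' (ω := ω ++ ψ)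
      (cs.isReflection_simple i) (by omega)
    by_cases hjω : j < ω.length
    · rw [List.eraseIdx_append_of_lt_length hjω, wordProd_append, wordProd_append, ← mul_assoc,
        mul_left_inj, ← wordProd_cons] at he
      have h2 := cs.length_wordProd_le (ω.eraseIdx j)
      rw [← he, hω.eq, List.length_eraseIdx_of_lt hjω, List.length_cons] at h2
      omega
    · rw [List.length_append] at hj
      rw [List.eraseIdx_append_of_length_le (by omega), wordProd_append, wordProd_append] at he
      have hz : (cs.wordProd ω)⁻¹ * cs.simple i * cs.wordProd ω ∈ cs.parabolic J :=
        mul_mem (mul_mem (inv_mem (cs.wordProd_mem_parabolic hJ'))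
          (cs.simple_mem_parabolic (hJ i (by simp)))) (cs.wordProd_mem_parabolic hJ')
      have h2 := (cs.bruhatLE_parabolic_mul hu hz).length_le
      have h3 : (cs.wordProd ω)⁻¹ * cs.simple i * cs.wordProd ω * cs.wordProd ψ =
          cs.wordProd (ψ.eraseIdx (j - ω.length)) := by
        simp only [mul_assoc]
        rw [he, inv_mul_cancel_left]
      have h4 := cs.length_wordProd_le (ψ.eraseIdx (j - ω.length))
      rw [List.length_eraseIdx_of_lt (by omega)] at h4
      rw [h3, hψ.eq] at h2
      omega

theorem length_mul_parabolic {J : Set B} {u z : W}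
    (hu : ∀ i ∈ J, ¬ cs.IsRightDescent u i) (hz : z ∈ cs.parabolic J) :
    cs.length (u * z) = cs.length u + cs.length z := by
  have := cs.length_parabolic_mul (J := J) (u := u⁻¹) (z := z⁻¹)
    (fun i hi => by rw [isLeftDescent_inv_iff]; exact hu i hi) (inv_mem hz)
  rw [← mul_inv_rev, length_inv, length_inv, length_inv, add_comm] at this
  exact this

/-- Lengths add, so z has length zero. This makes a witness trivial once the outer factors of r and
s agree. -/
theorem eq_one_of_parabolic_mul_bruhatLE {J : Set B} {u z : W}
    (hu : ∀ i ∈ J, ¬ cs.IsLeftDescent u i) (hz : z ∈ cs.parabolic J)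
    (h : cs.BruhatLE (z * u) u) : z = 1 := by
  have h1 := h.length_le
  rw [cs.length_parabolic_mul hu hz] at h1
  exact cs.length_eq_zero_iff.1 (by omega)

theorem eq_one_of_mul_parabolic_bruhatLE {J : Set B} {u z : W}
    (hu : ∀ i ∈ J, ¬ cs.IsRightDescent u i) (hz : z ∈ cs.parabolic J)
    (h : cs.BruhatLE (u * z) u) : z = 1 := by
  have h1 := h.length_le
  rw [cs.length_mul_parabolic hu hz] at h1
  exact cs.length_eq_zero_iff.1 (by omega)

theorem eq_of_parabolic_mul_eq {J : Set B} {u v z : W}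
    (hu : ∀ i ∈ J, ¬ cs.IsLeftDescent u i) (hv : ∀ i ∈ J, ¬ cs.IsLeftDescent v i)
    (hz : z ∈ cs.parabolic J) (h : z * u = v) : u = v := by
  have h1 := cs.length_parabolic_mul hu hz
  have h2 := cs.length_parabolic_mul hv (inv_mem hz)
  rw [← h, inv_mul_cancel_left, h1, length_inv] at h2
  rw [cs.length_eq_zero_iff.1 (by omega : cs.length z = 0), one_mul] at h
  exact h

theorem eq_of_mul_parabolic_eq {J : Set B} {u v z : W}
    (hu : ∀ i ∈ J, ¬ cs.IsRightDescent u i) (hv : ∀ i ∈ J, ¬ cs.IsRightDescent v i)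
    (hz : z ∈ cs.parabolic J) (h : u * z = v) : u = v := by
  have := cs.eq_of_parabolic_mul_eq (J := J) (u := u⁻¹) (v := v⁻¹) (z := z⁻¹)
    (fun i hi => by rw [isLeftDescent_inv_iff]; exact hu i hi)
    (fun i hi => by rw [isLeftDescent_inv_iff]; exact hv i hi) (inv_mem hz)
    (by rw [← h, mul_inv_rev])
  exact inv_injective this

theorem not_isLeftDescent_parabolic_mul {I J : Set B} (hIJ : I ⊆ J) {u z : W}
    (hu : ∀ i ∈ J, ¬ cs.IsLeftDescent u i) (hz : z ∈ cs.parabolic J)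
    (hz' : ∀ i ∈ I, ¬ cs.IsLeftDescent z i) : ∀ i ∈ I, ¬ cs.IsLeftDescent (z * u) i := by
  intro i hi
  have h := hz' i hi
  rw [IsLeftDescent] at h ⊢
  rw [← mul_assoc, cs.length_parabolic_mul hu hz,
    cs.length_parabolic_mul hu (mul_mem (cs.simple_mem_parabolic (hIJ hi)) hz)]
  omega

theorem not_isRightDescent_mul_parabolic {I J : Set B} (hIJ : I ⊆ J) {u z : W}
    (hu : ∀ i ∈ J, ¬ cs.IsRightDescent u i) (hz : z ∈ cs.parabolic J)
    (hz' : ∀ i ∈ I, ¬ cs.IsRightDescent z i) : ∀ i ∈ I, ¬ cs.IsRightDescent (u * z) i := by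
  intro i hi
  have h := hz' i hi
  rw [IsRightDescent] at h ⊢
  rw [mul_assoc, cs.length_mul_parabolic hu hz,
    cs.length_mul_parabolic hu (mul_mem hz (cs.simple_mem_parabolic (hIJ hi)))]
  omega

/-! ### Minimal representatives and descents -/

theorem mem_parabolicDoubleCoset {I J : Set B} {u v : W} :
    v ∈ cs.parabolicDoubleCoset I J u ↔
      ∃ x ∈ cs.parabolic I, ∃ y ∈ cs.parabolic J, v = x * u * y :=
  DoubleCoset.mem_doubleCoset

theorem not_isLeftDescent_of_forall_bruhatLE {I J : Set B} {u w : W}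
    (hw : u ∈ cs.parabolicDoubleCoset I J w)
    (hu : ∀ v ∈ cs.parabolicDoubleCoset I J w, cs.BruhatLE u v) :
    ∀ i ∈ I, ¬ cs.IsLeftDescent u i := by
  intro i hi
  obtain ⟨x, hx, y, hy, rfl⟩ := cs.mem_parabolicDoubleCoset.1 hw
  have := (hu (cs.simple i * (x * w * y)) (cs.mem_parabolicDoubleCoset.2
    ⟨cs.simple i * x, mul_mem (cs.simple_mem_parabolic hi) hx, y, hy,
      by simp [mul_assoc]⟩)).length_le
  exact not_lt.2 this

theorem not_isRightDescent_of_forall_bruhatLE {I J : Set B} {u w : W}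
    (hw : u ∈ cs.parabolicDoubleCoset I J w)
    (hu : ∀ v ∈ cs.parabolicDoubleCoset I J w, cs.BruhatLE u v) :
    ∀ i ∈ J, ¬ cs.IsRightDescent u i := by
  intro i hi
  obtain ⟨x, hx, y, hy, rfl⟩ := cs.mem_parabolicDoubleCoset.1 hw
  have := (hu (x * w * y * cs.simple i) (cs.mem_parabolicDoubleCoset.2
    ⟨x, hx, y * cs.simple i, mul_mem hy (cs.simple_mem_parabolic hi),
      by simp [mul_assoc]⟩)).length_le
  exact not_lt.2 this

theorem self_mem_parabolicDoubleCoset (I J : Set B) (u : W) :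
    u ∈ cs.parabolicDoubleCoset I J u :=
  cs.mem_parabolicDoubleCoset.2 ⟨1, one_mem _, 1, one_mem _, by simp⟩

theorem not_isLeftDescent_of_mem_minReps {I J : Set B} {u : W} (hu : u ∈ cs.minReps I J) :
    ∀ i ∈ I, ¬ cs.IsLeftDescent u i :=
  cs.not_isLeftDescent_of_forall_bruhatLE (cs.self_mem_parabolicDoubleCoset I J u) hu

theorem not_isRightDescent_of_mem_minReps {I J : Set B} {u : W} (hu : u ∈ cs.minReps I J) :
    ∀ i ∈ J, ¬ cs.IsRightDescent u i :=
  cs.not_isRightDescent_of_forall_bruhatLE (cs.self_mem_parabolicDoubleCoset I J u) hu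

theorem mem_minReps_of_not_isRightDescent {J : Set B} {u : W}
    (hu : ∀ i ∈ J, ¬ cs.IsRightDescent u i) : u ∈ cs.minReps ∅ J := by
  intro v hv
  obtain ⟨x, hx, y, hy, rfl⟩ := cs.mem_parabolicDoubleCoset.1 hv
  have hx1 : x = 1 := by simpa [parabolic] using hx
  rw [hx1, one_mul]
  exact cs.bruhatLE_mul_parabolic hu hy

/-! ### The longest element -/

section Longest

variable [Finite W]

/-- Every reduced word is a suffix of a reduced word of w₀. Write w₀ = pω with iω reduced. The
reflection ω⁻¹s_iω shortens w₀ by maximality; if s_i lengthened p, exchange would delete a letter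
from p or from ω, against the lengths of ps_i and iω. -/
theorem length_longest_mul_inv_add (u : W) :
    cs.length (cs.longest * u⁻¹) + cs.length u = cs.length cs.longest := by
  obtain ⟨ω, hω, rfl⟩ := cs.exists_isReduced u
  induction ω with
  | nil => simp
  | cons i ω ih =>
    have hr : cs.IsReduced ω := by simpa using hω.drop 1
    have ih := ih hr
    set p := cs.longest * (cs.wordProd ω)⁻¹ with hp
    have hpw : p * cs.wordProd ω = cs.longest := by simp [hp]
    have e : cs.longest * (cs.wordProd (i :: ω))⁻¹ = p * cs.simple i := by
      simp [hp, wordProd_cons, mul_assoc]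
    rw [e, hω.eq, List.length_cons]
    rw [hr.eq] at ih
    rcases cs.length_mul_simple p i with h1 | h1
    · exfalso
      obtain ⟨ψ, hψ, he⟩ := cs.exists_isReduced p
      have ht : cs.IsReflection ((cs.wordProd ω)⁻¹ * cs.simple i * cs.wordProd ω) := by
        simpa using (cs.isReflection_simple i).conj (cs.wordProd ω)⁻¹
      have hw : cs.wordProd (ψ ++ ω) = cs.longest := by rw [wordProd_append, ← he, hpw]
      have hlt : cs.length (cs.wordProd (ψ ++ ω) *
          ((cs.wordProd ω)⁻¹ * cs.simple i * cs.wordProd ω)) <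
          cs.length (cs.wordProd (ψ ++ ω)) := by
        have h2 := ht.length_mul_left_ne cs.longest
        have h3 := cs.length_le_length_longest
          (cs.longest * ((cs.wordProd ω)⁻¹ * cs.simple i * cs.wordProd ω))
        rw [hw]
        omega
      obtain ⟨j, hj, hje⟩ := cs.exists_eraseIdx_of_length_mul_lt ht hlt
      rw [List.length_append] at hj
      have hl : cs.wordProd (ψ ++ ω) * ((cs.wordProd ω)⁻¹ * cs.simple i * cs.wordProd ω) =
          p * (cs.simple i * cs.wordProd ω) := by
        rw [wordProd_append, ← he]; group
      rw [hl] at hje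
      by_cases hjψ : j < ψ.length
      · rw [List.eraseIdx_append_of_lt_length hjψ, wordProd_append, ← mul_assoc,
          mul_left_inj] at hje
        have h2 := cs.length_wordProd_le (ψ.eraseIdx j)
        rw [← hje, List.length_eraseIdx_of_lt hjψ, ← hψ.eq, ← he] at h2
        omega
      · rw [List.eraseIdx_append_of_length_le (by omega), wordProd_append, ← he,
          mul_right_inj, ← wordProd_cons] at hje
        have h2 := cs.length_wordProd_le (ω.eraseIdx (j - ψ.length))
        rw [← hje, hω.eq, List.length_eraseIdx_of_lt (by omega), List.length_cons] at h2
        omega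
    · omega

theorem length_longest_mul_add (u : W) :
    cs.length (cs.longest * u) + cs.length u = cs.length cs.longest := by
  simpa using cs.length_longest_mul_inv_add u⁻¹

@[simp] theorem longest_mul_longest : cs.longest * cs.longest = 1 := by
  have := cs.length_longest_mul_add cs.longest
  exact cs.length_eq_zero_iff.1 (by omega)

@[simp] theorem longest_inv : cs.longest⁻¹ = cs.longest :=
  inv_eq_of_mul_eq_one_right cs.longest_mul_longest

@[simp] theorem longest_mul_longest_mul (u : W) : cs.longest * (cs.longest * u) = u := by
  rw [← mul_assoc, longest_mul_longest, one_mul]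

@[simp] theorem mul_longest_mul_longest (u : W) : u * cs.longest * cs.longest = u := by
  rw [mul_assoc, longest_mul_longest, mul_one]

theorem length_mul_longest_add (u : W) :
    cs.length (u * cs.longest) + cs.length u = cs.length cs.longest := by
  have := cs.length_longest_mul_add u⁻¹
  rwa [← cs.length_inv (cs.longest * u⁻¹), mul_inv_rev, inv_inv, longest_inv, length_inv] at this

/-- Steps multiply on the left by reflections, so right multiplication by w₀ keeps each reflection
and complements the lengths. -/
theorem BruhatLE.mul_longest {u v : W} (h : cs.BruhatLE u v) :
    cs.BruhatLE (v * cs.longest) (u * cs.longest) := by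
  rw [bruhatLE_iff_chain] at h ⊢
  induction h with
  | refl => exact .refl
  | tail _ hst ih =>
    refine .head ?_ ih
    obtain ⟨t, ht, rfl, hl⟩ := hst
    rename_i b _
    refine ⟨t, ht, by simp [← mul_assoc, ht.mul_self], ?_⟩
    have h1 := cs.length_mul_longest_add b
    have h2 := cs.length_mul_longest_add (t * b)
    omega

theorem bruhatLE_mul_longest_iff {u v : W} :
    cs.BruhatLE (v * cs.longest) (u * cs.longest) ↔ cs.BruhatLE u v :=
  ⟨fun h => by simpa using BruhatLE.mul_longest cs h, fun h => BruhatLE.mul_longest cs h⟩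

theorem bruhatLE_longest_mul_iff {u v : W} :
    cs.BruhatLE (cs.longest * v) (cs.longest * u) ↔ cs.BruhatLE u v := by
  rw [← cs.bruhatLE_inv_iff, mul_inv_rev, mul_inv_rev, longest_inv, bruhatLE_mul_longest_iff,
    bruhatLE_inv_iff]

theorem exists_longest_conj_simple (i : B) :
    ∃ j, cs.longest * cs.simple i * cs.longest = cs.simple j := by
  refine cs.length_eq_one_iff.1 ?_
  have h1 := cs.length_mul_longest_add (cs.longest * cs.simple i)
  have h2 := cs.length_longest_mul_add (cs.simple i)
  rw [length_simple] at h2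
  omega

theorem longest_conj_mem_parabolic {I J : Set B}
    (h : ∀ i j, i ∈ I → cs.longest * cs.simple i * cs.longest = cs.simple j → j ∈ J) {w : W}
    (hw : w ∈ cs.parabolic I) : cs.longest * w * cs.longest ∈ cs.parabolic J := by
  induction hw using Subgroup.closure_induction with
  | mem x hx =>
    obtain ⟨i, hi, rfl⟩ := hx
    obtain ⟨j, hj⟩ := cs.exists_longest_conj_simple i
    rw [hj]
    exact cs.simple_mem_parabolic (h i j hi hj)
  | one => simp
  | mul x y _ _ hx hy => simpa [mul_assoc] using mul_mem hx hy
  | inv x _ hx => simpa [mul_assoc] using inv_mem hx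

end Longest

/-! ### Commuting parabolic subgroups -/

theorem not_isLeftDescent_of_disjoint {I K : Set B}
    (hd : ∀ i ∈ I, ∀ k ∈ K, cs.simple i ≠ cs.simple k) {v : W} (hv : v ∈ cs.parabolic K) :
    ∀ i ∈ I, ¬ cs.IsLeftDescent v i := by
  intro i hi h
  obtain ⟨k, hk, he⟩ := cs.exists_simple_eq_of_isLeftDescent hv h
  exact hd i hi k hk he

theorem not_isRightDescent_of_disjoint {I K : Set B}
    (hd : ∀ i ∈ I, ∀ k ∈ K, cs.simple i ≠ cs.simple k) {v : W} (hv : v ∈ cs.parabolic K) :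
    ∀ i ∈ I, ¬ cs.IsRightDescent v i := by
  intro i hi h
  exact cs.not_isLeftDescent_of_disjoint hd (inv_mem hv) i hi (cs.isLeftDescent_inv_iff.2 h)

/-- If a simple reflection outside `I` normalizes `W_I`, then it commutes with each generator. -/
theorem commute_simple_of_conj_mem {I : Set B} {i k : B} (hi : i ∈ I)
    (hk : ∀ j ∈ I, cs.simple j ≠ cs.simple k)
    (hn : cs.simple k * cs.simple i * cs.simple k ∈ cs.parabolic I) :
    Commute (cs.simple i) (cs.simple k) := by
  set z := cs.simple k * cs.simple i * cs.simple k with hz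
  have hdesc : ∀ j ∈ I, ¬ cs.IsLeftDescent (cs.simple k) j :=
    cs.not_isLeftDescent_of_disjoint (K := {k}) (by simpa using hk)
      (cs.simple_mem_parabolic rfl)
  -- Since zs_k = s_k s_i and lengths add in zs_k, z is a simple reflection s_m. Exchange in s_m s_k
  -- = s_k s_i then leaves s_i = s_k, which is excluded, or s_i = s_m.
  have h1 := cs.length_parabolic_mul hdesc hn
  have hzk : z * cs.simple k = cs.simple k * cs.simple i := by simp [hz]
  have h2 := cs.length_mul_le (cs.simple k) (cs.simple i)
  have hz0 : cs.length z ≠ 0 := by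
    rw [Ne, length_eq_zero_iff]
    intro h0
    rw [h0, one_mul] at hzk
    have := mul_eq_left.1 hzk.symm
    have h3 := cs.length_simple i
    rw [this, length_one] at h3
    omega
  rw [hzk] at h1
  simp only [length_simple] at h1 h2
  have hz1 : cs.length z = 1 := by omega
  obtain ⟨m, hm⟩ := cs.length_eq_one_iff.1 hz1
  have hw : cs.wordProd [m, k] = cs.simple k * cs.simple i := by
    rw [wordProd_cons, wordProd_singleton, ← hm, hzk]
  obtain ⟨j, hj, he⟩ := cs.exists_eraseIdx_of_length_mul_lt' (ω := [m, k])
    (cs.isReflection_simple k) (by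
      rw [hw, simple_mul_simple_cancel_left, length_simple, h1]; omega)
  rw [hw, simple_mul_simple_cancel_left] at he
  have hj2 : j = 0 ∨ j = 1 := by simp at hj; omega
  rcases hj2 with rfl | rfl
  · exact absurd (by simpa using he) (hk i hi)
  · have he' : cs.simple i = cs.simple m := by simpa using he
    rw [Commute, SemiconjBy, he', ← hm, hzk, hm, ← he']

theorem commute_of_mem_parabolic {I K : Set B}
    (h : ∀ i ∈ I, ∀ k ∈ K, Commute (cs.simple i) (cs.simple k)) {u v : W}
    (hu : u ∈ cs.parabolic I) (hv : v ∈ cs.parabolic K) : Commute u v := by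
  have h1 : cs.parabolic I ≤ Subgroup.centralizer (cs.parabolic K) := by
    refine (Subgroup.closure_le _).2 ?_
    rintro _ ⟨i, hi, rfl⟩
    have h2 : cs.parabolic K ≤ Subgroup.centralizer {cs.simple i} := by
      refine (Subgroup.closure_le _).2 ?_
      rintro _ ⟨k, hk, rfl⟩
      exact Subgroup.mem_centralizer_singleton_iff.2 (h i hi k hk).symm.eq
    exact Subgroup.mem_centralizer_iff.2 fun y hy =>
      Subgroup.mem_centralizer_singleton_iff.1 (h2 hy)
  exact (Subgroup.mem_centralizer_iff.1 (h1 hu) v hv).symm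

theorem exists_mul_of_mem_parabolic_union {I K : Set B}
    (h : ∀ i ∈ I, ∀ k ∈ K, Commute (cs.simple i) (cs.simple k)) {w : W}
    (hw : w ∈ cs.parabolic (I ∪ K)) :
    ∃ v ∈ cs.parabolic K, ∃ u ∈ cs.parabolic I, w = v * u := by
  induction hw using Subgroup.closure_induction with
  | mem x hx =>
    obtain ⟨i, hi | hi, rfl⟩ := hx
    · exact ⟨1, one_mem _, _, cs.simple_mem_parabolic hi, by simp⟩
    · exact ⟨_, cs.simple_mem_parabolic hi, 1, one_mem _, by simp⟩
  | one => exact ⟨1, one_mem _, 1, one_mem _, by simp⟩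
  | mul x y _ _ hx hy =>
    obtain ⟨v, hv, u, hu, rfl⟩ := hx
    obtain ⟨v', hv', u', hu', rfl⟩ := hy
    refine ⟨v * v', mul_mem hv hv', u * u', mul_mem hu hu', ?_⟩
    have := (cs.commute_of_mem_parabolic h hu hv').eq
    rw [mul_assoc v u, ← mul_assoc u v' u', this]
    simp only [mul_assoc]
  | inv x _ hx =>
    obtain ⟨v, hv, u, hu, rfl⟩ := hx
    refine ⟨v⁻¹, inv_mem hv, u⁻¹, inv_mem hu, ?_⟩
    rw [mul_inv_rev]
    exact (cs.commute_of_mem_parabolic h (inv_mem hu) (inv_mem hv)).eq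

theorem length_mul_of_disjoint {I K : Set B}
    (hd : ∀ i ∈ I, ∀ k ∈ K, cs.simple i ≠ cs.simple k) {u v : W}
    (hu : u ∈ cs.parabolic I) (hv : v ∈ cs.parabolic K) :
    cs.length (u * v) = cs.length u + cs.length v :=
  cs.length_parabolic_mul (cs.not_isLeftDescent_of_disjoint hd hv) hu

/-- Left multiplication by w₀ complements lengths, and v adds the same amount to the lengths of u
and of us_i, so v does not affect descents in I. -/
theorem not_isRightDescent_longest_mul [Finite W] {I K : Set B}
    (hd : ∀ i ∈ I, ∀ k ∈ K, cs.simple i ≠ cs.simple k)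
    (hc : ∀ i ∈ I, ∀ k ∈ K, Commute (cs.simple i) (cs.simple k)) {u v : W} (hu : u ∈ cs.parabolic I)
    (hv : v ∈ cs.parabolic K) (h : ∀ i ∈ I, ¬ cs.IsRightDescent (cs.longest * u) i) :
    ∀ i ∈ I, ¬ cs.IsRightDescent (cs.longest * (u * v)) i := by
  intro i hi
  have h0 := h i hi
  have hi' := cs.simple_mem_parabolic hi
  have e : u * v * cs.simple i = u * cs.simple i * v := by
    rw [mul_assoc, ← (cs.commute_of_mem_parabolic hc hi' hv).eq, mul_assoc]
  rw [IsRightDescent, mul_assoc] at h0 ⊢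
  rw [e]
  have h1 := cs.length_longest_mul_add u
  have h2 := cs.length_longest_mul_add (u * cs.simple i)
  have h3 := cs.length_longest_mul_add (u * v)
  have h4 := cs.length_longest_mul_add (u * cs.simple i * v)
  rw [cs.length_mul_of_disjoint hd hu hv] at h3
  rw [cs.length_mul_of_disjoint hd (mul_mem hu hi') hv] at h4
  omega

theorem not_isLeftDescent_longest_mul [Finite W] {I K : Set B}
    (hd : ∀ i ∈ I, ∀ k ∈ K, cs.simple i ≠ cs.simple k) {I' : Set B}
    (hI' : ∀ i j, i ∈ I' → cs.longest * cs.simple i * cs.longest = cs.simple j → j ∈ I)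
    {u v : W} (hu : u ∈ cs.parabolic I) (hv : v ∈ cs.parabolic K)
    (h : ∀ i ∈ I', ¬ cs.IsLeftDescent (cs.longest * u) i) :
    ∀ i ∈ I', ¬ cs.IsLeftDescent (cs.longest * (u * v)) i := by
  intro i hi
  have h0 := h i hi
  obtain ⟨j, hj⟩ := cs.exists_longest_conj_simple i
  have hi' := cs.simple_mem_parabolic (hI' i j hi hj)
  have e : ∀ x, cs.simple i * (cs.longest * x) = cs.longest * (cs.simple j * x) := by
    intro x; rw [← hj]; simp [mul_assoc]
  rw [IsLeftDescent, e] at h0 ⊢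
  rw [← mul_assoc (cs.simple j)]
  have h1 := cs.length_longest_mul_add u
  have h2 := cs.length_longest_mul_add (cs.simple j * u)
  have h3 := cs.length_longest_mul_add (u * v)
  have h4 := cs.length_longest_mul_add (cs.simple j * u * v)
  rw [cs.length_mul_of_disjoint hd hu hv] at h3
  rw [cs.length_mul_of_disjoint hd (mul_mem hi' hu) hv] at h4
  omega

end CoxeterSystem

/-! ### Factorizable monoids -/

section Monoids

variable {R : Type*} [Monoid R]

theorem GreenJ.exists_eq {r s : R} (h : GreenJ r s) : ∃ a b, r = a * s * b := by
  have h1 : r ∈ {x : R | ∃ a b, x = a * r * b} := ⟨1, 1, by simp⟩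
  rw [h] at h1
  exact h1

theorem GreenJ.symm {r s : R} (h : GreenJ r s) : GreenJ s r := Eq.symm h

theorem GreenJ.trans {r s t : R} (h : GreenJ r s) (h' : GreenJ s t) : GreenJ r t := Eq.trans h h'

theorem greenJ_of_eq {r s a b a' b' : R} (h : r = a * s * b) (h' : s = a' * r * b') :
    GreenJ r s := by
  ext x
  constructor
  · rintro ⟨c, d, rfl⟩
    exact ⟨c * a, b * d, by rw [h]; simp only [mul_assoc]⟩
  · rintro ⟨c, d, rfl⟩
    exact ⟨c * a', b' * d, by rw [h']; simp only [mul_assoc]⟩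

theorem GreenL.exists_eq {r s : R} (h : GreenL r s) : ∃ a, r = a * s := by
  have h1 : r ∈ {x : R | ∃ a, x = a * r} := ⟨1, by simp⟩
  rw [h] at h1
  exact h1

theorem GreenR.exists_eq {r s : R} (h : GreenR r s) : ∃ b, r = s * b := by
  have h1 : r ∈ {x : R | ∃ b, x = r * b} := ⟨1, by simp⟩
  rw [h] at h1
  exact h1

theorem GreenL.symm {r s : R} (h : GreenL r s) : GreenL s r := Eq.symm h

theorem GreenR.symm {r s : R} (h : GreenR r s) : GreenR s r := Eq.symm h

theorem GreenL.greenJ {r s : R} (h : GreenL r s) : GreenJ r s := by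
  obtain ⟨a, ha⟩ := h.exists_eq
  obtain ⟨b, hb⟩ := h.symm.exists_eq
  exact greenJ_of_eq (b := 1) (b' := 1) (by rwa [mul_one]) (by rwa [mul_one])

theorem GreenR.greenJ {r s : R} (h : GreenR r s) : GreenJ r s := by
  obtain ⟨a, ha⟩ := h.exists_eq
  obtain ⟨b, hb⟩ := h.symm.exists_eq
  exact greenJ_of_eq (a := 1) (a' := 1) (by rwa [one_mul]) (by rwa [one_mul])

theorem isIdempotentElem_units_conj {e : R} (he : IsIdempotentElem e) (g : Rˣ) :
    IsIdempotentElem ((g : R) * e * ((g⁻¹ : Rˣ) : R)) := by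
  rw [IsIdempotentElem]
  calc (g : R) * e * ((g⁻¹ : Rˣ) : R) * (g * e * ((g⁻¹ : Rˣ) : R))
      = g * (e * (((g⁻¹ : Rˣ) : R) * g) * e) * ((g⁻¹ : Rˣ) : R) := by simp only [mul_assoc]
    _ = _ := by rw [Units.inv_mul, mul_one, he.eq]

namespace IsFactorizable

variable (hR : IsFactorizable R)
include hR

/-- Divisibility gives qp = p and pq = q, and idempotents commute. -/
theorem eq_of_dvd_dvd {p q a b : R} (hp : IsIdempotentElem p) (hq : IsIdempotentElem q)
    (h : p = q * a) (h' : q = p * b) : p = q := by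
  have h1 : q * p = p := by rw [h, ← mul_assoc, hq.eq]
  have h2 : p * q = q := by rw [h', ← mul_assoc, hp.eq]
  rw [← h1, hR.idem_comm q p hq hp, h2]

theorem eq_of_dvd_dvd_left {p q a b : R} (hp : IsIdempotentElem p) (hq : IsIdempotentElem q)
    (h : p = a * q) (h' : q = b * p) : p = q := by
  have h1 : p * q = p := by rw [h, mul_assoc, hq.eq]
  have h2 : q * p = q := by rw [h', mul_assoc, hp.eq]
  rw [← h1, hR.idem_comm p q hp hq, h2]

theorem eq_of_mul_units_eq {p q : R} (hp : IsIdempotentElem p) (hq : IsIdempotentElem q)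
    {u v : Rˣ} (h : p * u = q * v) : p = q :=
  hR.eq_of_dvd_dvd hp hq (a := v * ((u⁻¹ : Rˣ) : R)) (b := u * ((v⁻¹ : Rˣ) : R))
    (by rw [← mul_assoc, ← h, Units.mul_inv_cancel_right])
    (by rw [← mul_assoc, h, Units.mul_inv_cancel_right])

/-- In a finite factorizable monoid, `J`-equivalent idempotents are conjugate. -/
theorem exists_conj_of_greenJ [Finite R] {e f : R} (he : IsIdempotentElem e)
    (hf : IsIdempotentElem f) (h : GreenJ e f) :
    ∃ g : Rˣ, (g : R) * f * ((g⁻¹ : Rˣ) : R) = e := by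
  -- If x = ayb, left multiplication by a maps yR onto a set containing xR, so J-equivalent elements
  -- have principal right ideals of equal size.
  have key : ∀ {x y : R}, GreenJ x y → ({z : R | ∃ b, z = x * b}).ncard ≤
      ({z : R | ∃ b, z = y * b}).ncard := by
    intro x y hxy
    obtain ⟨a, b, hab⟩ := hxy.exists_eq
    have hsub : {z : R | ∃ b, z = x * b} ⊆ (a * ·) '' {z : R | ∃ b, z = y * b} := by
      rintro _ ⟨c, rfl⟩
      exact ⟨y * (b * c), ⟨b * c, rfl⟩, by simp only [hab, mul_assoc]⟩
    exact (Set.ncard_le_ncard hsub (Set.toFinite _)).trans (Set.ncard_image_le (Set.toFinite _))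
  obtain ⟨a, b, hab⟩ := h.exists_eq
  obtain ⟨g, e₁, he₁, rfl⟩ := hR.exists_unit_mul_idem a
  obtain ⟨e₂, g₂, he₂, rfl⟩ := hR.exists_idem_mul_unit b
  have hk : IsIdempotentElem (e₁ * f) :=
    IsIdempotentElem.mul_of_commute (hR.idem_comm _ _ he₁ hf) he₁ hf
  have hh : IsIdempotentElem (e₁ * f * e₂) :=
    IsIdempotentElem.mul_of_commute (hR.idem_comm _ _ hk he₂) hk he₂
  -- k is an idempotent below f, and e = gkg₂ forces e = gkg⁻¹. Since kR ⊆ fR have equal size, k =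
  -- f.
  set k := e₁ * f * e₂ with hkdef
  have hkf : k = f * (e₁ * e₂) := by
    rw [hkdef, hR.idem_comm _ _ he₁ hf, mul_assoc]
  have hge : (g : R) * k * ((g⁻¹ : Rˣ) : R) = e := by
    refine hR.eq_of_mul_units_eq (u := g * g₂) (v := 1) (isIdempotentElem_units_conj hh g) he ?_
    rw [Units.val_one, mul_one, hab, hkdef, Units.val_mul]
    simp only [mul_assoc, Units.inv_mul_cancel_left]
  have hJ : GreenJ f k := by
    refine h.symm.trans (greenJ_of_eq hge.symm (a' := ((g⁻¹ : Rˣ) : R)) (b' := g) ?_)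
    rw [← hge]
    simp only [mul_assoc, Units.inv_mul_cancel_left, Units.inv_mul, mul_one]
  have hsub : {z : R | ∃ b, z = k * b} ⊆ {z : R | ∃ b, z = f * b} := by
    rintro _ ⟨c, rfl⟩
    exact ⟨e₁ * e₂ * c, by rw [hkf]; simp only [mul_assoc]⟩
  have heq := Set.eq_of_subset_of_ncard_le hsub (key hJ) (Set.toFinite _)
  have hf' : f ∈ {z : R | ∃ b, z = k * b} := by rw [heq]; exact ⟨1, by simp⟩
  obtain ⟨c, hc⟩ := hf'
  rw [hR.eq_of_dvd_dvd hf hh hc hkf]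
  exact ⟨g, hge⟩

end IsFactorizable

end Monoids

/-! ### Type maps and the longest element -/

namespace CoxeterSystem

variable {R B : Type*} [Monoid R] {M : CoxeterMatrix B} (cs : CoxeterSystem M Rˣ)

theorem typeMap_eq_union (e : R) : cs.typeMap e = cs.lowerType e ∪ cs.upperType e := by
  ext i
  constructor
  · intro h
    by_cases h1 : (cs.simple i : R) * e = e
    · exact Or.inl ⟨h1, by rw [← show (cs.simple i : R) * e = e * cs.simple i from h, h1]⟩
    · exact Or.inr ⟨h, h1⟩
  · rintro (h | h)
    · exact h.1.trans h.2.symm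
    · exact h.1

theorem lowerType_subset_typeMap (e : R) : cs.lowerType e ⊆ cs.typeMap e := by
  rw [typeMap_eq_union]; exact Set.subset_union_left

theorem upperType_subset_typeMap (e : R) : cs.upperType e ⊆ cs.typeMap e := by
  rw [typeMap_eq_union]; exact Set.subset_union_right

theorem simple_ne_of_lowerType_of_upperType (e : R) :
    ∀ i ∈ cs.lowerType e, ∀ k ∈ cs.upperType e, cs.simple i ≠ cs.simple k := by
  intro i hi k hk h
  exact hk.2 (h ▸ hi.1)

section Longest

variable [Finite R]

@[simp] theorem coe_longest_mul_longest : (cs.longest : R) * cs.longest = 1 := by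
  rw [← Units.val_mul, longest_mul_longest, Units.val_one]

@[simp] theorem coe_longest_mul_longest_mul (x : R) :
    (cs.longest : R) * (cs.longest * x) = x := by
  rw [← mul_assoc, coe_longest_mul_longest, one_mul]

variable {cs} {e e' : R}

theorem eq_longest_conj_symm (h : e' = (cs.longest : R) * e * cs.longest) :
    e = (cs.longest : R) * e' * cs.longest := by
  simp [h, mul_assoc]

/-- The axioms speak of Λ only; this transports type information between e₋ ∈ Λ⁻ and e₊ ∈ Λ. -/
theorem simple_mul_of_longest_conj (h : e' = (cs.longest : R) * e * cs.longest) {i j : B}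
    (hj : cs.longest * cs.simple i * cs.longest = cs.simple j) :
    (cs.simple j : R) * e = cs.longest * (cs.simple i * e') * cs.longest ∧
      e * cs.simple j = cs.longest * (e' * cs.simple i) * cs.longest := by
  simp [h, ← hj, mul_assoc]

theorem mem_typeMap_of_longest_conj (h : e' = (cs.longest : R) * e * cs.longest) (i j : B)
    (hi : i ∈ cs.typeMap e') (hj : cs.longest * cs.simple i * cs.longest = cs.simple j) :
    j ∈ cs.typeMap e := by
  obtain ⟨h1, h2⟩ := simple_mul_of_longest_conj h hj
  change (cs.simple j : R) * e = e * cs.simple j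
  rw [h1, h2, show (cs.simple i : R) * e' = e' * cs.simple i from hi]

theorem mem_lowerType_of_longest_conj (h : e' = (cs.longest : R) * e * cs.longest) (i j : B)
    (hi : i ∈ cs.lowerType e') (hj : cs.longest * cs.simple i * cs.longest = cs.simple j) :
    j ∈ cs.lowerType e := by
  obtain ⟨h1, h2⟩ := simple_mul_of_longest_conj h hj
  refine ⟨?_, ?_⟩
  · rw [h1, hi.1, ← eq_longest_conj_symm h]
  · rw [h2, hi.2, ← eq_longest_conj_symm h]

theorem mem_upperType_of_longest_conj (h : e' = (cs.longest : R) * e * cs.longest) (i j : B)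
    (hi : i ∈ cs.upperType e') (hj : cs.longest * cs.simple i * cs.longest = cs.simple j) :
    j ∈ cs.upperType e := by
  refine ⟨mem_typeMap_of_longest_conj h i j hi.1 hj, fun h0 => hi.2 ?_⟩
  rw [(simple_mul_of_longest_conj h hj).1] at h0
  calc (cs.simple i : R) * e' = cs.longest * (cs.longest * (cs.simple i * e') * cs.longest) *
        cs.longest := by simp [mul_assoc]
    _ = e' := by rw [h0, h]

end Longest

end CoxeterSystem

/-! ### Generalized Renner-Coxeter systems -/

namespace RennerCoxeterSystem

open CoxeterSystem

variable {R B : Type*} [Monoid R] {M : CoxeterMatrix B} (Q : RennerCoxeterSystem R M)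

/-- s_k commutes with e, so s_k s_i s_k still fixes e and lies in W_{λ_*(e)}; a simple reflection
outside that normalizes in this way must commute. -/
theorem commute_lowerType_upperType {e : R} (he : e ∈ Q.Lam) :
    ∀ i ∈ Q.cs.lowerType e, ∀ k ∈ Q.cs.upperType e,
      Commute (Q.cs.simple i) (Q.cs.simple k) := by
  intro i hi k hk
  refine Q.cs.commute_simple_of_conj_mem hi
    (fun j hj => Q.cs.simple_ne_of_lowerType_of_upperType e j hj k hk) ?_
  rw [← Q.fix_iff_mem_parabolic_lowerType he]
  have h1 : (Q.cs.simple k : R) * e = e * Q.cs.simple k := hk.1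
  have h2 : (Q.cs.simple k : R) * Q.cs.simple k = 1 := by
    rw [← Units.val_mul, simple_mul_simple_self, Units.val_one]
  simp only [Units.val_mul]
  constructor
  · rw [mul_assoc, h1, mul_assoc, ← mul_assoc _ e, hi.1, ← h1, ← mul_assoc, h2, one_mul]
  · rw [← mul_assoc, ← mul_assoc, ← h1, mul_assoc _ e, hi.2, h1, mul_assoc, h2, mul_one]

theorem exists_mul_of_mem_typeMap {e : R} (he : e ∈ Q.Lam) {w : Rˣ}
    (hw : w ∈ Q.cs.parabolic (Q.cs.typeMap e)) :
    ∃ v ∈ Q.cs.parabolic (Q.cs.upperType e), ∃ u ∈ Q.cs.parabolic (Q.cs.lowerType e),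
      w = v * u := by
  rw [typeMap_eq_union] at hw
  exact Q.cs.exists_mul_of_mem_parabolic_union (Q.commute_lowerType_upperType he) hw

theorem eq_of_conj {e f : R} (he : e ∈ Q.Lam) (hf : f ∈ Q.Lam) {g : Rˣ}
    (h : (g : R) * e * ((g⁻¹ : Rˣ) : R) = f) : e = f := by
  obtain ⟨x, -, hx⟩ := Q.transversal e (Q.idem_of_mem e he)
  rw [hx f ⟨hf, g, h⟩, hx e ⟨he, 1, by simp⟩]

theorem eq_of_greenJ [Finite R] {e f : R} (he : e ∈ Q.Lam) (hf : f ∈ Q.Lam) (h : GreenJ e f) :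
    e = f := by
  obtain ⟨g, hg⟩ := Q.factorizable.exists_conj_of_greenJ (Q.idem_of_mem e he) (Q.idem_of_mem f hf) h
  exact (Q.eq_of_conj hf he hg).symm

/-- The left standard form of an element is unique. -/
theorem IsLeftStandardForm.unique {Q : RennerCoxeterSystem R M} {r : R} {x y x' y' : Rˣ} {e e' : R}
    (h : Q.IsLeftStandardForm r x e y) (h' : Q.IsLeftStandardForm r x' e' y') :
    x = x' ∧ e = e' ∧ y = y' := by
  have he := Q.idem_of_mem e h.mem
  have he' := Q.idem_of_mem e' h'.mem
  have heq : (x : R) * e * y = x' * e' * y' := h.eq.symm.trans h'.eq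
  have hx : (x : R) * e * ((x⁻¹ : Rˣ) : R) = x' * e' * ((x'⁻¹ : Rˣ) : R) := by
    refine Q.factorizable.eq_of_mul_units_eq (u := x * y) (v := x' * y')
      (isIdempotentElem_units_conj he x) (isIdempotentElem_units_conj he' x') ?_
    simpa [mul_assoc] using heq
  obtain rfl : e = e' := by
    refine Q.eq_of_conj h.mem h'.mem (g := x'⁻¹ * x) ?_
    calc ((x'⁻¹ * x : Rˣ) : R) * e * (((x'⁻¹ * x)⁻¹ : Rˣ) : R)
        = ((x'⁻¹ : Rˣ) : R) * (x * e * ((x⁻¹ : Rˣ) : R)) * x' := by simp [mul_assoc]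
      _ = e' := by rw [hx]; simp [mul_assoc]
  have hc : ((x'⁻¹ * x : Rˣ) : R) * e = e * (x'⁻¹ * x : Rˣ) := by
    calc ((x'⁻¹ * x : Rˣ) : R) * e
        = ((x'⁻¹ : Rˣ) : R) * (x * e * ((x⁻¹ : Rˣ) : R)) * x := by simp [mul_assoc]
      _ = _ := by rw [hx]; simp [mul_assoc]
  have hey : e * ((x'⁻¹ * x * y : Rˣ) : R) = e * y' := by
    calc e * ((x'⁻¹ * x * y : Rˣ) : R) = e * (x'⁻¹ * x : Rˣ) * y := by
          rw [Units.val_mul (x'⁻¹ * x), mul_assoc]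
      _ = ((x'⁻¹ : Rˣ) : R) * (x * e * y) := by rw [← hc]; simp [mul_assoc]
      _ = e * y' := by rw [heq]; simp [mul_assoc]
  have hfix : e * ((x'⁻¹ * x * y * y'⁻¹ : Rˣ) : R) = e := by
    rw [Units.val_mul _ y'⁻¹, ← mul_assoc, hey, Units.mul_inv_cancel_right]
  set z := x'⁻¹ * x * y * y'⁻¹ with hz
  -- From ez = e, the idempotents e and zez⁻¹ are left multiples of each other, hence equal.
  have hzc : (z : R) * e = e * z := by
    have h2 : e = (z : R) * e * ((z⁻¹ : Rˣ) : R) := by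
      refine Q.factorizable.eq_of_dvd_dvd_left he (isIdempotentElem_units_conj he z)
        (a := ((z⁻¹ : Rˣ) : R)) (b := z) ?_ ?_
      · have h3 : e * ((z⁻¹ : Rˣ) : R) = e := by
          conv_lhs => rw [← hfix]
          rw [Units.mul_inv_cancel_right]
        rw [mul_assoc (z : R), Units.inv_mul_cancel_left, h3]
      · have h3 : e * ((z⁻¹ : Rˣ) : R) = e := by
          conv_lhs => rw [← hfix]
          rw [Units.mul_inv_cancel_right]
        rw [mul_assoc, h3]
    calc (z : R) * e = (z : R) * e * ((z⁻¹ : Rˣ) : R) * z := by simp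
      _ = e * z := by rw [← h2]
  have hw1 := (Q.comm_iff_mem_parabolic_typeMap h.mem _).1 hc
  have hw2 := (Q.comm_iff_mem_parabolic_typeMap h.mem _).1 hzc
  have hy : y = y' := by
    refine Q.cs.eq_of_parabolic_mul_eq (Q.cs.not_isLeftDescent_of_mem_minReps h.right_min)
      (Q.cs.not_isLeftDescent_of_mem_minReps h'.right_min)
      (z := z⁻¹ * (x'⁻¹ * x)) (MulMemClass.mul_mem (inv_mem hw2) hw1) ?_
    rw [hz]; group
  refine ⟨?_, rfl, hy⟩
  have hz' : z = x'⁻¹ * x := by rw [hz, hy]; group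
  have hw3 := (Q.fix_iff_mem_parabolic_lowerType h.mem z).1 ⟨hzc.trans hfix, hfix⟩
  refine Q.cs.eq_of_mul_parabolic_eq (Q.cs.not_isRightDescent_of_mem_minReps h.left_min)
    (Q.cs.not_isRightDescent_of_mem_minReps h'.left_min) (inv_mem hw3) ?_
  rw [hz']; group

/-- Uniqueness of left standard forms removes the choice of forms from the definition. -/
theorem adherenceLE_iff {r s : R} {x y a b : Rˣ} {e : R}
    (hr : Q.IsLeftStandardForm r x e y) (hs : Q.IsLeftStandardForm s a e b) :
    Q.AdherenceLE r s ↔ ∃ v ∈ Q.cs.parabolic (Q.cs.upperType e),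
      ∃ u ∈ Q.cs.parabolic (Q.cs.lowerType e),
        Q.cs.BruhatLE x (a * (v * u)) ∧ Q.cs.BruhatLE ((v * u)⁻¹ * b) y := by
  constructor
  · rintro ⟨x', e', y', a', f', b', hr', hs', -, w, ⟨v, hv, u, hu, rfl⟩, h1, h2⟩
    obtain ⟨rfl, rfl, rfl⟩ := hr.unique hr'
    obtain ⟨rfl, rfl, rfl⟩ := hs.unique hs'
    exact ⟨v, hv, u, hu, h1, h2⟩
  · rintro ⟨v, hv, u, hu, h1, h2⟩
    have he := Q.idem_of_mem e hr.mem
    exact ⟨x, e, y, a, e, b, hr, hs, ⟨he, he⟩, v * u, ⟨v, hv, u, hu, rfl⟩, h1, h2⟩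

end RennerCoxeterSystem

namespace RennerCoxeterSystem

open CoxeterSystem

variable {R B : Type*} [Monoid R] [Finite R] {M : CoxeterMatrix B} {Q : RennerCoxeterSystem R M}

/-! ### Vanilla forms -/

namespace IsVanillaForm

variable {r : R} {σm σ0 σp : Rˣ} {em ep : R} (h : Q.IsVanillaForm r σm em σ0 ep σp)
include h

/-- The element f of Λ with e₋ = w₀fw₀ is J-equivalent to e₊, and a J-class meets Λ at most once. -/
theorem em_eq : em = (Q.cs.longest : R) * ep * Q.cs.longest := by
  obtain ⟨f, hf, he⟩ := h.em_mem
  have hJ : GreenJ f em := greenJ_of_eq (CoxeterSystem.eq_longest_conj_symm he) he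
  rw [← Q.eq_of_greenJ hf h.ep_mem ((hJ.trans h.em_greenJ).trans h.ep_greenJ), he]

theorem ep_eq : ep = (Q.cs.longest : R) * em * Q.cs.longest :=
  eq_longest_conj_symm h.em_eq

theorem not_isLeftDescent_σp : ∀ i ∈ Q.cs.typeMap ep, ¬ Q.cs.IsLeftDescent σp i :=
  Q.cs.not_isLeftDescent_of_mem_minReps h.σp_min

theorem not_isRightDescent_σm : ∀ i ∈ Q.cs.typeMap em, ¬ Q.cs.IsRightDescent σm i :=
  Q.cs.not_isRightDescent_of_mem_minReps h.σm_min

/-- Moving the left-hand factors of σ₀ across w₀ turns parabolics of e₋ into those of e₊; as λ_* and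
λ^* parts commute, they collect into u and v. The minimal double coset element is w₀u. -/
theorem exists_σ0_eq : ∃ u ∈ Q.cs.parabolic (Q.cs.lowerType ep),
    ∃ v ∈ Q.cs.parabolic (Q.cs.upperType ep), σ0 = Q.cs.longest * (u * v) ∧
      (∀ i ∈ Q.cs.lowerType ep, ¬ Q.cs.IsRightDescent (Q.cs.longest * u) i) ∧
      (∀ i ∈ Q.cs.lowerType em, ¬ Q.cs.IsLeftDescent (Q.cs.longest * u) i) := by
  obtain ⟨d, ⟨hd, hmin⟩, hσ⟩ := h.σ0_mem
  have hR := Q.cs.not_isRightDescent_of_forall_bruhatLE hd hmin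
  have hL := Q.cs.not_isLeftDescent_of_forall_bruhatLE hd hmin
  obtain ⟨x, hx, y, hy, rfl⟩ := Q.cs.mem_parabolicDoubleCoset.1 hd
  obtain ⟨p, hp, q, hq, rfl⟩ := Q.cs.mem_parabolicDoubleCoset.1 hσ
  have hx' := longest_conj_mem_parabolic _ (mem_lowerType_of_longest_conj h.em_eq) hx
  have hp' := longest_conj_mem_parabolic _ (mem_upperType_of_longest_conj h.em_eq) hp
  have e : x * Q.cs.longest * y = Q.cs.longest * (Q.cs.longest * x * Q.cs.longest * y) := by
    simp [mul_assoc]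
  have hu := MulMemClass.mul_mem hx' hy
  refine ⟨_, hu, _, MulMemClass.mul_mem hp' hq, ?_, by rwa [← e], by rwa [← e]⟩
  have hc := (Q.cs.commute_of_mem_parabolic (Q.commute_lowerType_upperType h.ep_mem) hu hp').eq
  rw [← mul_assoc _ _ q, hc]
  simp [mul_assoc]

theorem not_isRightDescent_σ0 : ∀ i ∈ Q.cs.lowerType ep, ¬ Q.cs.IsRightDescent σ0 i := by
  obtain ⟨u, hu, v, hv, rfl, hR, -⟩ := h.exists_σ0_eq
  exact Q.cs.not_isRightDescent_longest_mul (Q.cs.simple_ne_of_lowerType_of_upperType ep)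
    (Q.commute_lowerType_upperType h.ep_mem) hu hv hR

theorem not_isLeftDescent_σ0 : ∀ i ∈ Q.cs.lowerType em, ¬ Q.cs.IsLeftDescent σ0 i := by
  obtain ⟨u, hu, v, hv, rfl, -, hL⟩ := h.exists_σ0_eq
  exact Q.cs.not_isLeftDescent_longest_mul (Q.cs.simple_ne_of_lowerType_of_upperType ep)
    (mem_lowerType_of_longest_conj h.em_eq) hu hv hL

theorem longest_mul_σ0_mem : Q.cs.longest * σ0 ∈ Q.cs.parabolic (Q.cs.typeMap ep) := by
  obtain ⟨u, hu, v, hv, rfl, -⟩ := h.exists_σ0_eq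
  rw [longest_mul_longest_mul]
  exact MulMemClass.mul_mem (Q.cs.parabolic_mono (Q.cs.lowerType_subset_typeMap ep) hu)
    (Q.cs.parabolic_mono (Q.cs.upperType_subset_typeMap ep) hv)

theorem conj_mem {w : Rˣ} (hw : w ∈ Q.cs.parabolic (Q.cs.typeMap ep)) :
    Q.cs.longest * w * Q.cs.longest ∈ Q.cs.parabolic (Q.cs.typeMap em) :=
  longest_conj_mem_parabolic _ (mem_typeMap_of_longest_conj h.ep_eq) hw

theorem σ0_mul_longest_mem : σ0 * Q.cs.longest ∈ Q.cs.parabolic (Q.cs.typeMap em) := by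
  simpa using h.conj_mem h.longest_mul_σ0_mem

theorem em_mul_σ0 : em * σ0 = σ0 * ep := by
  have h1 := (Q.comm_iff_mem_parabolic_typeMap h.ep_mem _).2 h.longest_mul_σ0_mem
  rw [Units.val_mul, mul_assoc] at h1
  calc em * σ0 = Q.cs.longest * (ep * (Q.cs.longest * σ0)) := by rw [h.em_eq]; simp [mul_assoc]
    _ = σ0 * ep := by rw [← h1, coe_longest_mul_longest_mul]

/-- Length additivity in σ₋(σ₀w₀) gives ℓ(σ₋σ₀) = ℓ(σ₀) - ℓ(σ₋), and likewise with σ₀s for s ∈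
λ_*(e₊). So σ₋σ₀ inherits the absence of such descents from σ₀. -/
theorem isLeftStandardForm : Q.IsLeftStandardForm r (σm * σ0) ep σp := by
  refine ⟨?_, h.ep_mem, ?_, h.σp_min⟩
  · rw [h.eq, mul_assoc (σm : R), h.em_mul_σ0, Units.val_mul]
    simp only [mul_assoc]
    rw [← mul_assoc ep, (Q.idem_of_mem ep h.ep_mem).eq]
  · refine Q.cs.mem_minReps_of_not_isRightDescent fun i hi => ?_
    have h0 := h.not_isRightDescent_σ0 i hi
    rw [IsRightDescent] at h0 ⊢
    have hm := h.σ0_mul_longest_mem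
    have hs := h.conj_mem (Q.cs.simple_mem_parabolic (Q.cs.lowerType_subset_typeMap ep hi))
    have e : σ0 * Q.cs.longest * (Q.cs.longest * Q.cs.simple i * Q.cs.longest) =
        σ0 * Q.cs.simple i * Q.cs.longest := by simp [mul_assoc]
    have h1 := Q.cs.length_mul_parabolic h.not_isRightDescent_σm hm
    have h2 := Q.cs.length_mul_parabolic h.not_isRightDescent_σm (MulMemClass.mul_mem hm hs)
    rw [e] at h2
    have h3 := Q.cs.length_mul_longest_add σ0
    have h4 := Q.cs.length_mul_longest_add (σ0 * Q.cs.simple i)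
    have h5 := Q.cs.length_mul_longest_add (σm * σ0)
    have h6 := Q.cs.length_mul_longest_add (σm * σ0 * Q.cs.simple i)
    rw [← mul_assoc] at h1
    rw [← mul_assoc, ← mul_assoc] at h2
    omega

theorem not_isRightDescent_mul : ∀ i ∈ Q.cs.lowerType ep, ¬ Q.cs.IsRightDescent (σm * σ0) i :=
  Q.cs.not_isRightDescent_of_mem_minReps h.isLeftStandardForm.left_min

theorem commute_em : ∀ i ∈ Q.cs.lowerType em, ∀ k ∈ Q.cs.upperType em,
    Commute (Q.cs.simple i) (Q.cs.simple k) := by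
  intro i hi k hk
  obtain ⟨i', hi'⟩ := Q.cs.exists_longest_conj_simple i
  obtain ⟨k', hk'⟩ := Q.cs.exists_longest_conj_simple k
  have hc := (Q.commute_lowerType_upperType h.ep_mem i' (mem_lowerType_of_longest_conj h.em_eq i i'
    hi hi') k' (mem_upperType_of_longest_conj h.em_eq k k' hk hk')).eq
  rw [← hi', ← hk'] at hc
  exact mul_right_cancel (b := Q.cs.longest) (by simpa [mul_assoc] using hc)

theorem exists_mul_of_mem_em {w : Rˣ} (hw : w ∈ Q.cs.parabolic (Q.cs.typeMap em)) :
    ∃ v ∈ Q.cs.parabolic (Q.cs.upperType em), ∃ u ∈ Q.cs.parabolic (Q.cs.lowerType em),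
      w = v * u := by
  rw [typeMap_eq_union] at hw
  exact Q.cs.exists_mul_of_mem_parabolic_union h.commute_em hw

theorem not_isLeftDescent_mul_σp {v : Rˣ} (hv : v ∈ Q.cs.parabolic (Q.cs.upperType ep)) :
    ∀ i ∈ Q.cs.lowerType ep, ¬ Q.cs.IsLeftDescent (v * σp) i :=
  Q.cs.not_isLeftDescent_parabolic_mul (Q.cs.lowerType_subset_typeMap ep) h.not_isLeftDescent_σp
    (Q.cs.parabolic_mono (Q.cs.upperType_subset_typeMap ep) hv)
    (Q.cs.not_isLeftDescent_of_disjoint (Q.cs.simple_ne_of_lowerType_of_upperType ep) hv)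

theorem not_isRightDescent_σm_mul {v : Rˣ} (hv : v ∈ Q.cs.parabolic (Q.cs.upperType em)) :
    ∀ i ∈ Q.cs.lowerType em, ¬ Q.cs.IsRightDescent (σm * v) i :=
  Q.cs.not_isRightDescent_mul_parabolic (Q.cs.lowerType_subset_typeMap em) h.not_isRightDescent_σm
    (Q.cs.parabolic_mono (Q.cs.upperType_subset_typeMap em) hv)
    (Q.cs.not_isRightDescent_of_disjoint (Q.cs.simple_ne_of_lowerType_of_upperType em) hv)

omit h in
theorem eq_of_greenJ {s : R} {τm τ0 τp : Rˣ} {fm fp : R}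
    (hr : Q.IsVanillaForm r σm em σ0 ep σp) (hs : Q.IsVanillaForm s τm fm τ0 fp τp)
    (hJ : GreenJ r s) : em = fm ∧ ep = fp := by
  have h1 : ep = fp :=
    Q.eq_of_greenJ hr.ep_mem hs.ep_mem ((hr.ep_greenJ.symm.trans hJ).trans hs.ep_greenJ)
  exact ⟨by rw [hr.em_eq, hs.em_eq, h1], h1⟩

end IsVanillaForm

/-! ### Comparison of two vanilla forms with the same idempotents -/

section Comparison

variable {r s : R} {σm σ0 σp τm τ0 τp : Rˣ} {em ep : R}
  (hr : Q.IsVanillaForm r σm em σ0 ep σp) (hs : Q.IsVanillaForm s τm em τ0 ep τp)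
include hr hs

/-- The W_{λ_*(e₊)} part of the witness is superfluous: σ₋σ₀ has no right descents there, and v⁻¹τ₊
has no left ones. -/
theorem adherenceLE_iff_of_isVanillaForm :
    Q.AdherenceLE r s ↔
      ∃ v ∈ Q.cs.parabolic (Q.cs.upperType ep),
        Q.cs.BruhatLE (σm * σ0) (τm * τ0 * v) ∧ Q.cs.BruhatLE (v⁻¹ * τp) σp := by
  rw [Q.adherenceLE_iff hr.isLeftStandardForm hs.isLeftStandardForm]
  constructor
  · rintro ⟨v, hv, u, hu, h1, h2⟩
    refine ⟨v, hv, ?_, ?_⟩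
    · rw [← mul_assoc] at h1
      exact h1.of_mul_parabolic _ hr.not_isRightDescent_mul hu
    · rw [mul_inv_rev, mul_assoc] at h2
      exact (Q.cs.bruhatLE_parabolic_mul (hs.not_isLeftDescent_mul_σp (inv_mem hv))
        (inv_mem hu)).trans h2
  · rintro ⟨v, hv, h1, h2⟩
    exact ⟨v, hv, 1, one_mem _, by simpa using h1, by simpa using h2⟩

theorem adherenceLE_iff_of_greenJ :
    Q.AdherenceLE r s ↔
      ∃ wm ∈ Q.cs.parabolic (Q.cs.upperType em), ∃ wp ∈ Q.cs.parabolic (Q.cs.upperType ep),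
        Q.cs.BruhatLE (τm * wm⁻¹) σm ∧ Q.cs.BruhatLE σ0 (wm * τ0 * wp) ∧
          Q.cs.BruhatLE (wp⁻¹ * τp) σp := by
  rw [adherenceLE_iff_of_isVanillaForm hr hs]
  have hlen := Q.cs.length_mul_parabolic hr.not_isRightDescent_σm hr.σ0_mul_longest_mem
  constructor
  · rintro ⟨v, hv, h1, h2⟩
    replace h1 := h1.mul_longest
    rw [mul_assoc σm] at h1
    obtain ⟨p, q, hpq, hp, hq⟩ := h1.exists_mul_of_length_add _ hlen
    have hqmem := hq.mem_parabolic _ hr.σ0_mul_longest_mem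
    have hA : τ0 * v * Q.cs.longest ∈ Q.cs.parabolic (Q.cs.typeMap em) := by
      have := MulMemClass.mul_mem hs.σ0_mul_longest_mem
        (hs.conj_mem (Q.cs.parabolic_mono (Q.cs.upperType_subset_typeMap ep) hv))
      simpa [mul_assoc] using this
    -- Here cu = τ₀vw₀q⁻¹, so p = τ₋cu. The witness w₋ is c⁻¹, and u is absorbed by the minimality
    -- of τ₋c on one side and of σ₀ on the other.
    obtain ⟨c, hc, u, hu, hcu⟩ := hr.exists_mul_of_mem_em (MulMemClass.mul_mem hA (inv_mem hqmem))
    have hp' : p = τm * c * u := by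
      rw [mul_assoc, ← hcu, eq_mul_inv_of_mul_eq hpq.symm]
      simp only [mul_assoc]
    have hq' : q = u⁻¹ * c⁻¹ * τ0 * v * Q.cs.longest := by
      rw [← mul_inv_rev, ← hcu]; group
    refine ⟨c⁻¹, inv_mem hc, v, hv, ?_, ?_, h2⟩
    · rw [inv_inv]
      rw [hp'] at hp
      exact (Q.cs.bruhatLE_mul_parabolic (hs.not_isRightDescent_σm_mul hc) hu).trans hp
    · rw [hq', bruhatLE_mul_longest_iff] at hq
      refine BruhatLE.of_parabolic_mul _ hr.not_isLeftDescent_σ0 (inv_mem hu) ?_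
      simpa only [mul_assoc] using hq
  · rintro ⟨wm, hwm, wp, hwp, h1, h2, h3⟩
    refine ⟨wp, hwp, ?_, h3⟩
    have h4 := h1.mul_of_length_add _ h2.mul_longest hlen
    rw [← mul_assoc σm, ← mul_assoc, bruhatLE_mul_longest_iff] at h4
    simpa [mul_assoc] using h4

/-- L-equivalence identifies the idempotents σ₊⁻¹e₊σ₊ and τ₊⁻¹e₊τ₊, so τ₊σ₊⁻¹ centralizes e₊ and
both are minimal in one coset of W_{λ(e₊)}. -/
theorem σp_eq_of_greenL (h : GreenL r s) : σp = τp := by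
  have he := Q.idem_of_mem ep hr.ep_mem
  have key : ∀ {r s : R} {x y a b : Rˣ}, r = x * ep * y → s = a * ep * b → GreenL r s →
      ∃ c : R, ((y⁻¹ : Rˣ) : R) * ep * y = c * (((b⁻¹ : Rˣ) : R) * ep * b) := by
    intro r s x y a b h1 h2 h3
    obtain ⟨c, hc⟩ := h3.exists_eq
    refine ⟨((y⁻¹ : Rˣ) : R) * ((x⁻¹ : Rˣ) : R) * c * a * b, ?_⟩
    calc ((y⁻¹ : Rˣ) : R) * ep * y = ((y⁻¹ : Rˣ) : R) * ((x⁻¹ : Rˣ) : R) * (x * ep * y) := by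
          simp [mul_assoc]
      _ = _ := by rw [← h1, hc, h2]; simp [mul_assoc]
  have h1 := hr.isLeftStandardForm.eq
  have h2 := hs.isLeftStandardForm.eq
  obtain ⟨c, hc⟩ := key h1 h2 h
  obtain ⟨c', hc'⟩ := key h2 h1 h.symm
  have heq := Q.factorizable.eq_of_dvd_dvd_left
    (by simpa using isIdempotentElem_units_conj he σp⁻¹)
    (by simpa using isIdempotentElem_units_conj he τp⁻¹) hc hc'
  have hmem : τp * σp⁻¹ ∈ Q.cs.parabolic (Q.cs.typeMap ep) := by
    rw [← Q.comm_iff_mem_parabolic_typeMap hr.ep_mem]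
    calc ((τp * σp⁻¹ : Rˣ) : R) * ep
        = τp * (((σp⁻¹ : Rˣ) : R) * ep * σp) * ((σp⁻¹ : Rˣ) : R) := by simp [mul_assoc]
      _ = ep * ((τp * σp⁻¹ : Rˣ) : R) := by rw [heq]; simp [mul_assoc]
  exact Q.cs.eq_of_parabolic_mul_eq hr.not_isLeftDescent_σp hs.not_isLeftDescent_σp hmem (by group)

theorem σm_eq_of_greenR (h : GreenR r s) : σm = τm := by
  have he := Q.idem_of_mem ep hr.ep_mem
  -- Writing e₋ = w₀e₊w₀ leaves only σ₋w₀ to the left of e₊, so R-equivalence does not involve σ₀.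
  have hform : ∀ {r : R} {σm σ0 σp : Rˣ}, Q.IsVanillaForm r σm em σ0 ep σp →
      r = ((σm * Q.cs.longest : Rˣ) : R) * ep * ((Q.cs.longest * σ0 * σp : Rˣ) : R) := by
    intro r σm σ0 σp hr
    rw [hr.isLeftStandardForm.eq, Units.val_mul σm, mul_assoc (σm : R), ← hr.em_mul_σ0, hr.em_eq]
    simp [mul_assoc]
  have key : ∀ {r s : R} {x y a b : Rˣ}, r = x * ep * y → s = a * ep * b → GreenR r s →
      ∃ c : R, (x : R) * ep * ((x⁻¹ : Rˣ) : R) = (a * ep * ((a⁻¹ : Rˣ) : R)) * c := by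
    intro r s x y a b h1 h2 h3
    obtain ⟨c, hc⟩ := h3.exists_eq
    refine ⟨a * b * c * ((y⁻¹ : Rˣ) : R) * ((x⁻¹ : Rˣ) : R), ?_⟩
    calc (x : R) * ep * ((x⁻¹ : Rˣ) : R)
        = (x * ep * y) * ((y⁻¹ : Rˣ) : R) * ((x⁻¹ : Rˣ) : R) := by simp [mul_assoc]
      _ = _ := by rw [← h1, hc, h2]; simp [mul_assoc]
  obtain ⟨c, hc⟩ := key (hform hr) (hform hs) h
  obtain ⟨c', hc'⟩ := key (hform hs) (hform hr) h.symm
  have heq := Q.factorizable.eq_of_dvd_dvd (isIdempotentElem_units_conj he _)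
    (isIdempotentElem_units_conj he _) hc hc'
  have hmem : (σm * Q.cs.longest)⁻¹ * (τm * Q.cs.longest) ∈
      Q.cs.parabolic (Q.cs.typeMap ep) := by
    rw [← Q.comm_iff_mem_parabolic_typeMap hr.ep_mem]
    generalize σm * Q.cs.longest = x at heq
    generalize τm * Q.cs.longest = a at heq
    calc ((x⁻¹ * a : Rˣ) : R) * ep
        = ((x⁻¹ : Rˣ) : R) * (a * ep * ((a⁻¹ : Rˣ) : R)) * a := by simp [mul_assoc]
      _ = ep * ((x⁻¹ * a : Rˣ) : R) := by rw [← heq]; simp [mul_assoc]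
  refine Q.cs.eq_of_mul_parabolic_eq hr.not_isRightDescent_σm hs.not_isRightDescent_σm
    (hr.conj_mem hmem) ?_
  simp [mul_assoc]

theorem adherenceLE_iff_of_greenL (h : GreenL r s) :
    Q.AdherenceLE r s ↔ Q.cs.BruhatLE (σm * σ0) (τm * τ0) := by
  obtain rfl := σp_eq_of_greenL hr hs h
  rw [adherenceLE_iff_of_isVanillaForm hr hs]
  constructor
  · rintro ⟨v, hv, h1, h2⟩
    have hv1 := Q.cs.eq_one_of_parabolic_mul_bruhatLE hr.not_isLeftDescent_σp
      (Q.cs.parabolic_mono (Q.cs.upperType_subset_typeMap ep) (inv_mem hv)) h2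
    rwa [inv_eq_one.1 hv1, mul_one] at h1
  · intro h1
    exact ⟨1, one_mem _, by simpa using h1, by simpa using Q.cs.bruhatLE_refl σp⟩

theorem adherenceLE_iff_exists_of_greenR (h : GreenR r s) :
    Q.AdherenceLE r s ↔ ∃ wp ∈ Q.cs.parabolic (Q.cs.upperType ep),
      Q.cs.BruhatLE σ0 (τ0 * wp) ∧ Q.cs.BruhatLE (wp⁻¹ * τp) σp := by
  obtain rfl := σm_eq_of_greenR hr hs h
  rw [adherenceLE_iff_of_greenJ hr hs]
  constructor
  · rintro ⟨wm, hwm, wp, hwp, h1, h2, h3⟩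
    have hv1 := Q.cs.eq_one_of_mul_parabolic_bruhatLE hr.not_isRightDescent_σm
      (Q.cs.parabolic_mono (Q.cs.upperType_subset_typeMap em) (inv_mem hwm)) h1
    rw [inv_eq_one.1 hv1, one_mul] at h2
    exact ⟨wp, hwp, h2, h3⟩
  · rintro ⟨wp, hwp, h2, h3⟩
    exact ⟨1, one_mem _, wp, hwp, by simpa using Q.cs.bruhatLE_refl σm, by simpa using h2, h3⟩

theorem adherenceLE_iff_of_greenR (h : GreenR r s) :
    Q.AdherenceLE r s ↔ Q.cs.BruhatLE (σ0 * σp) (τ0 * τp) := by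
  rw [adherenceLE_iff_exists_of_greenR hr hs h]
  have hlen := Q.cs.length_parabolic_mul hr.not_isLeftDescent_σp hr.longest_mul_σ0_mem
  constructor
  · rintro ⟨wp, hwp, h1, h2⟩
    rw [← bruhatLE_longest_mul_iff] at h1 ⊢
    have h3 := h1.mul_of_length_add _ h2 hlen
    simpa [mul_assoc] using h3
  · intro h1
    -- Now w₀ acts on the left: w₀σ₀ ∈ W_{λ(e₊)}, so lengths add in (w₀σ₀)σ₊ and the reversed
    -- inequality factors.
    rw [← bruhatLE_longest_mul_iff, ← mul_assoc _ σ0] at h1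
    obtain ⟨p, q, hpq, hp, hq⟩ := h1.exists_mul_of_length_add _ hlen
    have hpmem := hp.mem_parabolic _ hr.longest_mul_σ0_mem
    obtain ⟨v, hv, u, hu, hvu⟩ := Q.exists_mul_of_mem_typeMap hr.ep_mem
      (MulMemClass.mul_mem (inv_mem hs.longest_mul_σ0_mem) hpmem)
    have hp' : p = Q.cs.longest * (τ0 * v * u) := by
      rw [mul_assoc τ0, ← hvu]; group
    have hq' : q = u⁻¹ * (v⁻¹ * τp) := by
      rw [← mul_assoc, ← mul_inv_rev, ← hvu, eq_inv_mul_of_mul_eq hpq.symm]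
      group
    refine ⟨v, hv, ?_, ?_⟩
    · rw [hp', bruhatLE_longest_mul_iff] at hp
      exact hp.of_mul_parabolic _ hr.not_isRightDescent_σ0 hu
    · rw [hq'] at hq
      exact (Q.cs.bruhatLE_parabolic_mul (hs.not_isLeftDescent_mul_σp (inv_mem hv))
        (inv_mem hu)).trans hq

theorem adherenceLE_iff_of_greenH (h : GreenH r s) :
    Q.AdherenceLE r s ↔ Q.cs.BruhatLE σ0 τ0 := by
  obtain rfl := σp_eq_of_greenL hr hs h.1
  rw [adherenceLE_iff_exists_of_greenR hr hs h.2]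
  constructor
  · rintro ⟨v, hv, h1, h2⟩
    have hv1 := Q.cs.eq_one_of_parabolic_mul_bruhatLE hr.not_isLeftDescent_σp
      (Q.cs.parabolic_mono (Q.cs.upperType_subset_typeMap ep) (inv_mem hv)) h2
    rwa [inv_eq_one.1 hv1, mul_one] at h1
  · intro h1
    exact ⟨1, one_mem _, by simpa using h1, by simpa using Q.cs.bruhatLE_refl σp⟩

end Comparison

end RennerCoxeterSystem

open RennerCoxeterSystem in
theorem mainTheorem8 {R B : Type*} [Monoid R] [Finite R] {M : CoxeterMatrix B}
    (Q : RennerCoxeterSystem R M) (r s : R)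
    (σm σ0 σp τm τ0 τp : Rˣ) (em ep fm fp : R)
    (hr : Q.IsVanillaForm r σm em σ0 ep σp) (hs : Q.IsVanillaForm s τm fm τ0 fp τp) :
    (GreenJ r s → (Q.AdherenceLE r s ↔
      ∃ wm ∈ Q.cs.parabolic (Q.cs.upperType em), ∃ wp ∈ Q.cs.parabolic (Q.cs.upperType ep),
        Q.cs.BruhatLE (τm * wm⁻¹) σm ∧ Q.cs.BruhatLE σ0 (wm * τ0 * wp) ∧
          Q.cs.BruhatLE (wp⁻¹ * τp) σp)) ∧
    (GreenL r s → (Q.AdherenceLE r s ↔ Q.cs.BruhatLE (σm * σ0) (τm * τ0))) ∧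
    (GreenR r s → (Q.AdherenceLE r s ↔ Q.cs.BruhatLE (σ0 * σp) (τ0 * τp))) ∧
    (GreenH r s → (Q.AdherenceLE r s ↔ Q.cs.BruhatLE σ0 τ0)) := by
  refine ⟨fun h => ?_, fun h => ?_, fun h => ?_, fun h => ?_⟩
  · obtain ⟨rfl, rfl⟩ := hr.eq_of_greenJ hs h
    exact adherenceLE_iff_of_greenJ hr hs
  · obtain ⟨rfl, rfl⟩ := hr.eq_of_greenJ hs h.greenJ
    exact adherenceLE_iff_of_greenL hr hs h
  · obtain ⟨rfl, rfl⟩ := hr.eq_of_greenJ hs h.greenJ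
    exact adherenceLE_iff_of_greenR hr hs h
  · obtain ⟨rfl, rfl⟩ := hr.eq_of_greenJ hs h.1.greenJ
    exact adherenceLE_iff_of_greenH hr hs h
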